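/- Let $N\ge 2$. Let $T$ be the torus obtained from the square $[0,N]\times[0,N]$ by identifying opposite sides, with horizontal circles $\alpha_i=\{y=i-1\}$ and vertical circles $\beta_i=\{x=i-1\}$ for $1\le i\le N$ (the underlying torus of a toroidal grid diagram of index $N$; its $X$ and $O$ markings play no role here). The $N^2$ components of $T\setminus\bigcup_i(\alpha_i\cup\beta_i)$ are the elementary domains, and a $2$-chain is a $\mathbb{Z}$-linear combination of them. Let $H_i$ be the horizontal annulus with $\alpha_i$ on its bottom and $V_i$ the vertical annulus with $\beta_i$ on its left, both regarded also as $2$-chains (the sum of their elementary domains). A generator is a set of $N$ points of the form $\{\alpha_i\cap\beta_{\sigma(i)} : 1\le i\le N\}$ with $\sigma\in\mathfrak S_N$; these points are its coordinates. A rectangle joining a generator $x$ to a generator $y$ is a $2$-chain with coefficients $0$ and $1$ whose support is an embedded closed disk bounded by arcs of two $\alpha$ circles and two $\beta$ circles, such that its bottom-left and top-right corners are coordinates of $x$, its top-left and bottom-right corners are coordinates of $y$, the other $N-2$ coordinates of $x$ and $y$ agree, and no coordinate of $x$ or $y$ lies in its interior. Let $\mathcal R(x,y)$ be the set of these; a rectangle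 is always considered together with the pair $(x,y)$. A sign assignment $s$ assigns to each rectangle a sign in $\{\pm1\}$ such that, whenever $x,y,z,z'$ are pairwise distinct generators and $R_1\in\mathcal R(x,z)$, $R_2\in\mathcal R(z,y)$, $R_1'\in\mathcal R(x,z')$, $R_2'\in\mathcal R(z',y)$ satisfy $R_1+R_2=R_1'+R_2'$ as $2$-chains, one has $s(R_1)s(R_2)=-s(R_1')s(R_2')$. Two sign assignments $s_1,s_2$ are gauge equivalent if there is a function $t$ from the set of generators to $\{\pm1\}$ with $s_1(R)=t(x)t(y)s_2(R)$ for all generators $x,y$ and all $R\in\mathcal R(x,y)$. For each generator $x$ and each $1\le i\le N$ there are a unique generator $z$ and unique rectangles $R\in\mathcal R(x,z)$, $R'\in\mathcal R(z,x)$ with $R+R'=H_i$; put $h_{s,x}(i)=s(R)s(R')$. Define $v_{s,x}(i)$ in the same way with $V_i$ in place of $H_i$. These signs depend only on the gauge equivalence class of $s$. **Theorem.** The functions $h_{s,x}$ and $v_{s,x}$ do not depend on the generator $x$ (so write $h_s$, $v_s$). The map $$\Phi:\ [s]\longmapsto (h_s(1),\dots,h_s(N),\,v_s(1),\dots,v_s(N-1))\in\{\pm1\}^{2N-1}$$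 from the set of gauge equivalence classes of sign assignments to $\{\pm1\}^{2N-1}$ is injective, and there are exactly $2^{2N-1}$ gauge equivalence classes of sign assignments. -/

import Mathlib

/-! # Sign assignments on toroidal grid diagrams

The circles `α_i` (horizontal) and `β_j` (vertical) of a toroidal grid diagram of index `N` are
indexed by `Fin N`, that is by `0, …, N - 1` in place of `1, …, N`; they run from bottom to top and
from left to right, cyclically. Subtraction in `Fin N` is subtraction modulo `N`. The elementary
domain `(col, row)` is the square with `β_col` on its left and `α_row` on its bottom.
The `X` and `O` markings of the diagram do not enter any of the notions below. -/

namespace Grid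

/-- A generator: the permutation `x` stands for the set of the points `α_i ∩ β_{x i}`. -/
abbrev Generator (N : ℕ) : Type := Equiv.Perm (Fin N)

/-- The integral `2`-chains generated by the elementary domains: `D col row` is the coefficient at
the elementary domain `(col, row)`. -/
abbrev Chain (N : ℕ) : Type := Fin N → Fin N → ℤ

/-- The unit intervals `[c, c + 1]` that make up the arc going from `a` in the positive direction
to `b` on the circle `ℤ/N`. -/
def InArc {N : ℕ} (a b c : Fin N) : Prop := (c - a).val < (b - a).val

/-- The integral points `c` strictly inside the arc going from `a` in the positive direction to `b`
on the circle `ℤ/N`. -/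
def InOpenArc {N : ℕ} (a b c : Fin N) : Prop := 0 < (c - a).val ∧ (c - a).val < (b - a).val

/-- A rectangle joining `x` to `y`: it is bounded by the circles `β_left`, `β_right`, `α_bottom`,
`α_top`; its bottom-left and top-right corners are coordinates of `x`; its top-left and
bottom-right corners are coordinates of `y`; all other coordinates of `x` and `y` agree; and no
coordinate of `x` or of `y` lies in its interior. -/
@[ext]
structure Rectangle {N : ℕ} (x y : Generator N) where
  left : Fin N
  right : Fin N
  bottom : Fin N
  top : Fin N
  left_ne_right : left ≠ right
  bottom_ne_top : bottom ≠ top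
  bottomLeft : x bottom = left
  topRight : x top = right
  topLeft : y top = left
  bottomRight : y bottom = right
  agree : ∀ i, i ≠ bottom → i ≠ top → x i = y i
  empty_source : ∀ i, ¬ (InOpenArc bottom top i ∧ InOpenArc left right (x i))
  empty_target : ∀ i, ¬ (InOpenArc bottom top i ∧ InOpenArc left right (y i))

open Classical in
/-- The `2`-chain of a rectangle, with coefficient `1` at the elementary domains that it covers and
`0` at all the others. -/
noncomputable def Rectangle.chain {N : ℕ} {x y : Generator N} (R : Rectangle x y) : Chain N :=
  fun col row => if InArc R.left R.right col ∧ InArc R.bottom R.top row then 1 else 0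

/-- A sign assignment. The group `ℤˣ` is `{1, -1}`. A rectangle remembers the generators that it
joins. -/
@[ext]
structure SignAssignment (N : ℕ) where
  sign : ∀ {x y : Generator N}, Rectangle x y → ℤˣ
  anticomm : ∀ {x y z z' : Generator N},
    x ≠ y → x ≠ z → x ≠ z' → y ≠ z → y ≠ z' → z ≠ z' →
    ∀ (R₁ : Rectangle x z) (R₂ : Rectangle z y) (R₁' : Rectangle x z') (R₂' : Rectangle z' y),
      R₁.chain + R₂.chain = R₁'.chain + R₂'.chain →
        sign R₁ * sign R₂ = -(sign R₁' * sign R₂')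

/-- Gauge equivalence of sign assignments. -/
def GaugeEquiv {N : ℕ} (s₁ s₂ : SignAssignment N) : Prop :=
  ∃ t : Generator N → ℤˣ, ∀ (x y : Generator N) (R : Rectangle x y),
    s₁.sign R = t x * t y * s₂.sign R

/-- Gauge equivalence is an equivalence relation. -/
def gaugeSetoid (N : ℕ) : Setoid (SignAssignment N) where
  r := GaugeEquiv
  iseqv :=
    { refl := fun _ => ⟨fun _ => 1, fun _ _ _ => by simp⟩
      symm := by
        rintro s₁ s₂ ⟨t, ht⟩
        refine ⟨t, fun x y R => ?_⟩
        rw [ht, ← mul_assoc, mul_mul_mul_comm, Int.units_mul_self, Int.units_mul_self]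
        simp
      trans := by
        rintro s₁ s₂ s₃ ⟨t, ht⟩ ⟨u, hu⟩
        refine ⟨fun x => t x * u x, fun x y R => ?_⟩
        rw [ht, hu, ← mul_assoc, mul_mul_mul_comm] }

/-- The set of gauge equivalence classes of sign assignments. -/
abbrev GaugeClass (N : ℕ) : Type := Quotient (gaugeSetoid N)

/-- The horizontal annulus `H_i`, bounded by `α_i` (below) and `α_{i+1}` (above), as a chain. -/
def horizontalAnnulus {N : ℕ} (i : Fin N) : Chain N := fun _ row => if row = i then 1 else 0

/-- The vertical annulus `V_j`, bounded by `β_j` (left) and `β_{j+1}` (right), as a chain. -/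
def verticalAnnulus {N : ℕ} (j : Fin N) : Chain N := fun col _ => if col = j then 1 else 0

/-- A decomposition of a chain `D`, as a domain from `x` to itself, into two rectangles. -/
structure Decomposition {N : ℕ} (x : Generator N) (D : Chain N) where
  mid : Generator N
  fst : Rectangle x mid
  snd : Rectangle mid x
  sum_eq : fst.chain + snd.chain = D

/-- The product of the signs of the two rectangles of a decomposition. -/
def Decomposition.signProd {N : ℕ} {x : Generator N} {D : Chain N} (d : Decomposition x D)
    (s : SignAssignment N) : ℤˣ := s.sign d.fst * s.sign d.snd

theorem val_sub_eq {N : ℕ} (a b : Fin N) :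
    (a - b).val = if b.val ≤ a.val then a.val - b.val else N + a.val - b.val := by
  have ha := a.isLt
  have hb := b.isLt
  rw [Fin.val_sub]
  split_ifs with h
  · rw [show N - b.val + a.val = (a.val - b.val) + N by omega, Nat.add_mod_right,
      Nat.mod_eq_of_lt (by omega)]
  · rw [Nat.mod_eq_of_lt (by omega)]
    omega

theorem inArc_left {N : ℕ} {a b : Fin N} (h : a ≠ b) : InArc a b a := by
  have h' : a.val ≠ b.val := fun e => h (Fin.ext e)
  have hb := b.isLt
  have ha := a.isLt
  unfold InArc
  rw [val_sub_eq, val_sub_eq]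
  split_ifs <;> omega

theorem inArc_swap {N : ℕ} {a b : Fin N} (h : a ≠ b) (c : Fin N) :
    InArc b a c ↔ ¬ InArc a b c := by
  have h' : a.val ≠ b.val := fun e => h (Fin.ext e)
  have ha := a.isLt
  have hb := b.isLt
  have hc := c.isLt
  unfold InArc
  simp only [val_sub_eq]
  split_ifs <;> omega

theorem Rectangle.chain_eq_one {N : ℕ} {x y : Generator N} (R : Rectangle x y) {col row : Fin N}
    (h : InArc R.left R.right col ∧ InArc R.bottom R.top row) : R.chain col row = 1 :=
  if_pos h

theorem Rectangle.chain_eq_zero {N : ℕ} {x y : Generator N} (R : Rectangle x y) {col row : Fin N}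
    (h : ¬ (InArc R.left R.right col ∧ InArc R.bottom R.top row)) : R.chain col row = 0 :=
  if_neg h

theorem Rectangle.chain_nonneg {N : ℕ} {x y : Generator N} (R : Rectangle x y) (col row : Fin N) :
    0 ≤ R.chain col row := by
  unfold Rectangle.chain
  split_ifs <;> simp

theorem Decomposition.fst_le {N : ℕ} {x : Generator N} {D : Chain N} (d : Decomposition x D)
    (col row : Fin N) : d.fst.chain col row ≤ D col row := by
  have h := congrFun (congrFun d.sum_eq col) row
  have h' := d.snd.chain_nonneg col row
  simp only [Pi.add_apply] at h
  omega

theorem Decomposition.snd_le {N : ℕ} {x : Generator N} {D : Chain N} (d : Decomposition x D)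
    (col row : Fin N) : d.snd.chain col row ≤ D col row := by
  have h := congrFun (congrFun d.sum_eq col) row
  have h' := d.fst.chain_nonneg col row
  simp only [Pi.add_apply] at h
  omega

/-- A rectangle is determined by its source and by the circles `α` on its bottom and its top. -/
theorem Rectangle.target_eq {N : ℕ} {x y z : Generator N} (R : Rectangle x y) (R' : Rectangle x z)
    (hb : R.bottom = R'.bottom) (ht : R.top = R'.top) : y = z := by
  ext1 i
  by_cases h₁ : i = R.bottom
  · rw [h₁, R.bottomRight, hb, R'.bottomRight, ← R.topRight, ← R'.topRight, ht]
  by_cases h₂ : i = R.top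
  · rw [h₂, R.topLeft, ht, R'.topLeft, ← R.bottomLeft, ← R'.bottomLeft, hb]
  rw [← R.agree i h₁ h₂, ← R'.agree i (hb ▸ h₁) (ht ▸ h₂)]

theorem Rectangle.eq_of_rows {N : ℕ} {x y : Generator N} (R R' : Rectangle x y)
    (hb : R.bottom = R'.bottom) (ht : R.top = R'.top) : R = R' := by
  ext1
  · rw [← R.bottomLeft, ← R'.bottomLeft, hb]
  · rw [← R.topRight, ← R'.topRight, ht]
  · exact hb
  · exact ht

theorem Decomposition.eq_of_rows {N : ℕ} {x : Generator N} {D : Chain N} (d d' : Decomposition x D)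
    (h₁ : d.fst.bottom = d'.fst.bottom) (h₂ : d.fst.top = d'.fst.top)
    (h₃ : d.snd.bottom = d'.snd.bottom) (h₄ : d.snd.top = d'.snd.top) : d = d' := by
  obtain ⟨z, R, S, e⟩ := d
  obtain ⟨z', R', S', e'⟩ := d'
  obtain rfl : z = z' := R.target_eq R' h₁ h₂
  obtain rfl := R.eq_of_rows R' h₁ h₂
  obtain rfl := S.eq_of_rows S' h₃ h₄
  rfl

theorem Decomposition.signProd_gauge {N : ℕ} {x : Generator N} {D : Chain N} (d : Decomposition x D)
    {s₁ s₂ : SignAssignment N} (h : GaugeEquiv s₁ s₂) : d.signProd s₁ = d.signProd s₂ := by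
  obtain ⟨t, ht⟩ := h
  unfold Decomposition.signProd
  rw [ht, ht, mul_mul_mul_comm, mul_comm (t d.mid) (t x), Int.units_mul_self, one_mul]

section Annuli

variable {N : ℕ} [N.AtLeastTwo]

theorem val_add_one_eq (i : Fin N) :
    (i + 1).val = if i.val + 1 = N then 0 else i.val + 1 := by
  have hN : 2 ≤ N := Nat.AtLeastTwo.prop
  have hi := i.isLt
  rw [Fin.val_add, Fin.val_one', Nat.mod_eq_of_lt (a := 1) (by omega)]
  split_ifs with h
  · rw [h, Nat.mod_self]
  · exact Nat.mod_eq_of_lt (by omega)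

theorem ne_add_one (i : Fin N) : i ≠ i + 1 := by
  intro h
  have h := congrArg Fin.val h
  have hN : 2 ≤ N := Nat.AtLeastTwo.prop
  rw [val_add_one_eq] at h
  split_ifs at h <;> omega

theorem inArc_add_one {i c : Fin N} : InArc i (i + 1) c ↔ c = i := by
  have hN : 2 ≤ N := Nat.AtLeastTwo.prop
  have hi := i.isLt
  have hc := c.isLt
  unfold InArc
  rw [Fin.ext_iff, val_sub_eq, val_sub_eq, val_add_one_eq]
  split_ifs <;> omega

theorem not_inOpenArc_add_one (i c : Fin N) : ¬ InOpenArc i (i + 1) c := by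
  rintro ⟨h₀, h⟩
  rw [show c = i from inArc_add_one.1 h, val_sub_eq] at h₀
  simp at h₀

theorem inArc_pred {a b : Fin N} (h : a ≠ b) : ∃ c, InArc a b c ∧ c + 1 = b := by
  obtain ⟨c, rfl⟩ : ∃ c, c + 1 = b := ⟨b - 1, sub_add_cancel b 1⟩
  refine ⟨c, ?_, rfl⟩
  have h' : a.val ≠ (c + 1).val := fun e => h (Fin.ext e)
  have ha := a.isLt
  have hc := c.isLt
  unfold InArc
  rw [val_add_one_eq] at h'
  rw [val_sub_eq, val_sub_eq, val_add_one_eq]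
  split_ifs at h' ⊢ <;> omega

/-- An arc that consists of the single unit interval `[i, i + 1]` goes from `i` to `i + 1`. -/
theorem eq_of_inArc_imp {a b i : Fin N} (hab : a ≠ b) (h : ∀ c, InArc a b c → c = i) :
    a = i ∧ b = i + 1 := by
  obtain ⟨c, hc, rfl⟩ := inArc_pred hab
  exact ⟨h a (inArc_left hab), by rw [h c hc]⟩

/-- A rectangle contained in the horizontal annulus `H_i` goes from `α_i` to `α_{i+1}`. -/
theorem Rectangle.of_le_horizontal {x y : Generator N} (R : Rectangle x y) (i : Fin N)
    (h : ∀ col row, R.chain col row ≤ horizontalAnnulus i col row) :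
    R.bottom = i ∧ R.top = i + 1 := by
  refine eq_of_inArc_imp R.bottom_ne_top fun c hc => ?_
  by_contra hci
  have := h R.left c
  simp [Rectangle.chain, horizontalAnnulus, hc, hci, inArc_left R.left_ne_right] at this

/-- A rectangle contained in the vertical annulus `V_j` goes from `β_j` to `β_{j+1}`. -/
theorem Rectangle.of_le_vertical {x y : Generator N} (R : Rectangle x y) (j : Fin N)
    (h : ∀ col row, R.chain col row ≤ verticalAnnulus j col row) :
    R.left = j ∧ R.right = j + 1 := by
  refine eq_of_inArc_imp R.left_ne_right fun c hc => ?_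
  by_contra hcj
  have := h c R.bottom
  simp [Rectangle.chain, verticalAnnulus, hc, hcj, inArc_left R.bottom_ne_top] at this

instance (x : Generator N) (i : Fin N) :
    Subsingleton (Decomposition x (horizontalAnnulus i)) where
  allEq d d' := by
    have h₁ := d.fst.of_le_horizontal i d.fst_le
    have h₂ := d.snd.of_le_horizontal i d.snd_le
    have h₁' := d'.fst.of_le_horizontal i d'.fst_le
    have h₂' := d'.snd.of_le_horizontal i d'.snd_le
    exact d.eq_of_rows d' (h₁.1.trans h₁'.1.symm) (h₁.2.trans h₁'.2.symm)
      (h₂.1.trans h₂'.1.symm) (h₂.2.trans h₂'.2.symm)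

instance (x : Generator N) (j : Fin N) :
    Subsingleton (Decomposition x (verticalAnnulus j)) where
  allEq d d' := by
    have h₁ := d.fst.of_le_vertical j d.fst_le
    have h₂ := d.snd.of_le_vertical j d.snd_le
    have h₁' := d'.fst.of_le_vertical j d'.fst_le
    have h₂' := d'.snd.of_le_vertical j d'.snd_le
    refine d.eq_of_rows d' (x.injective ?_) (x.injective ?_) (x.injective ?_) (x.injective ?_)
    · rw [d.fst.bottomLeft, d'.fst.bottomLeft, h₁.1, h₁'.1]
    · rw [d.fst.topRight, d'.fst.topRight, h₁.2, h₁'.2]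
    · rw [d.snd.bottomRight, d'.snd.bottomRight, h₂.2, h₂'.2]
    · rw [d.snd.topLeft, d'.snd.topLeft, h₂.1, h₂'.1]

/-- The unique decomposition of the horizontal annulus `H_i`, as a domain from `x` to itself, into
two rectangles. -/
def horizontalDecomposition (x : Generator N) (i : Fin N) :
    Decomposition x (horizontalAnnulus i) where
  mid := x * Equiv.swap i (i + 1)
  fst :=
    { left := x i
      right := x (i + 1)
      bottom := i
      top := i + 1
      left_ne_right := fun h => ne_add_one i (x.injective h)
      bottom_ne_top := ne_add_one i
      bottomLeft := rfl
      topRight := rfl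
      topLeft := by simp
      bottomRight := by simp
      agree := fun k h₁ h₂ => by simp [Equiv.swap_apply_of_ne_of_ne h₁ h₂]
      empty_source := fun k h => not_inOpenArc_add_one i k h.1
      empty_target := fun k h => not_inOpenArc_add_one i k h.1 }
  snd :=
    { left := x (i + 1)
      right := x i
      bottom := i
      top := i + 1
      left_ne_right := fun h => ne_add_one i (x.injective h.symm)
      bottom_ne_top := ne_add_one i
      bottomLeft := by simp
      topRight := by simp
      topLeft := rfl
      bottomRight := rfl
      agree := fun k h₁ h₂ => by simp [Equiv.swap_apply_of_ne_of_ne h₁ h₂]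
      empty_source := fun k h => not_inOpenArc_add_one i k h.1
      empty_target := fun k h => not_inOpenArc_add_one i k h.1 }
  sum_eq := by
    have hx : x i ≠ x (i + 1) := fun h => ne_add_one i (x.injective h)
    funext col row
    rw [Pi.add_apply, Pi.add_apply, horizontalAnnulus]
    by_cases h₂ : row = i
    · have h₂' := inArc_add_one.2 h₂
      rw [if_pos h₂]
      by_cases h₁ : InArc (x i) (x (i + 1)) col
      · rw [Rectangle.chain_eq_one _ ⟨h₁, h₂'⟩,
          Rectangle.chain_eq_zero _ fun h => (inArc_swap hx _).1 h.1 h₁, add_zero]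
      · rw [Rectangle.chain_eq_zero _ fun h => h₁ h.1,
          Rectangle.chain_eq_one _ ⟨(inArc_swap hx _).2 h₁, h₂'⟩, zero_add]
    · rw [if_neg h₂, Rectangle.chain_eq_zero _ fun h => h₂ (inArc_add_one.1 h.2),
        Rectangle.chain_eq_zero _ fun h => h₂ (inArc_add_one.1 h.2), add_zero]

/-- The unique decomposition of the vertical annulus `V_j`, as a domain from `x` to itself, into
two rectangles. -/
def verticalDecomposition (x : Generator N) (j : Fin N) :
    Decomposition x (verticalAnnulus j) where
  mid := x * Equiv.swap (x.symm j) (x.symm (j + 1))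
  fst :=
    { left := j
      right := j + 1
      bottom := x.symm j
      top := x.symm (j + 1)
      left_ne_right := ne_add_one j
      bottom_ne_top := fun h => ne_add_one j (x.symm.injective h)
      bottomLeft := by simp
      topRight := by simp
      topLeft := by simp
      bottomRight := by simp
      agree := fun k h₁ h₂ => by simp [Equiv.swap_apply_of_ne_of_ne h₁ h₂]
      empty_source := fun k h => not_inOpenArc_add_one j _ h.2
      empty_target := fun k h => not_inOpenArc_add_one j _ h.2 }
  snd :=
    { left := j
      right := j + 1
      bottom := x.symm (j + 1)
      top := x.symm j
      left_ne_right := ne_add_one j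
      bottom_ne_top := fun h => ne_add_one j (x.symm.injective h.symm)
      bottomLeft := by simp
      topRight := by simp
      topLeft := by simp
      bottomRight := by simp
      agree := fun k h₁ h₂ => by simp [Equiv.swap_apply_of_ne_of_ne h₂ h₁]
      empty_source := fun k h => not_inOpenArc_add_one j _ h.2
      empty_target := fun k h => not_inOpenArc_add_one j _ h.2 }
  sum_eq := by
    have hx : x.symm j ≠ x.symm (j + 1) := fun h => ne_add_one j (x.symm.injective h)
    funext col row
    rw [Pi.add_apply, Pi.add_apply, verticalAnnulus]
    by_cases h₂ : col = j
    · have h₂' := inArc_add_one.2 h₂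
      rw [if_pos h₂]
      by_cases h₁ : InArc (x.symm j) (x.symm (j + 1)) row
      · rw [Rectangle.chain_eq_one _ ⟨h₂', h₁⟩,
          Rectangle.chain_eq_zero _ fun h => (inArc_swap hx _).1 h.2 h₁, add_zero]
      · rw [Rectangle.chain_eq_zero _ fun h => h₁ h.2,
          Rectangle.chain_eq_one _ ⟨h₂', (inArc_swap hx _).2 h₁⟩, zero_add]
    · rw [if_neg h₂, Rectangle.chain_eq_zero _ fun h => h₂ (inArc_add_one.1 h.1),
        Rectangle.chain_eq_zero _ fun h => h₂ (inArc_add_one.1 h.1), add_zero]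

/-- The horizontal function `h_{s,x}`: the product of the signs of the two rectangles into which
`H_i`, as a domain from `x` to itself, decomposes. -/
def hFun (s : SignAssignment N) (x : Generator N) (i : Fin N) : ℤˣ :=
  (horizontalDecomposition x i).signProd s

/-- The vertical function `v_{s,x}`: the product of the signs of the two rectangles into which
`V_j`, as a domain from `x` to itself, decomposes. -/
def vFun (s : SignAssignment N) (x : Generator N) (j : Fin N) : ℤˣ :=
  (verticalDecomposition x j).signProd s

/-- The map `Φ`, with the horizontal and the vertical function computed at the generator `x`; the
pair consists of `(h_s(1), …, h_s(N))` and `(v_s(1), …, v_s(N-1))`. -/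
def Phi (x : Generator N) : GaugeClass N → (Fin N → ℤˣ) × (Fin (N - 1) → ℤˣ) :=
  Quotient.lift
    (fun s => (fun i => hFun s x i, fun j => vFun s x (j.castLE (Nat.sub_le N 1))))
    (fun _ _ h => Prod.ext (funext fun _ => Decomposition.signProd_gauge _ h)
      (funext fun _ => Decomposition.signProd_gauge _ h))

end Annuli

end Grid

/-! # Classification of sign assignments on toroidal grid diagrams

A rectangle with a given source `x` is determined by its bottom row `b` and its top row `t`, so that
a sign assignment is a function `F x b t` (`onRows`) for which the two factorizations of a domain
into two rectangles have opposite products (`IsCocycle (-1)`). The quotient of two sign assignments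
satisfies the same relation with equal products (`IsCocycle 1`); such functions are called flat
below. All the relations that are needed come from two disjoint rectangles of height one
(`IsCocycle.disjoint`) and from `L`-shapes (`IsCocycle.missing_topRight`, `.missing_topLeft`,
`.missing_bottomRight`).

*Independence of the generator.* Let `y` be obtained from `x` by an exchange of two adjacent rows.
If these are `i` and `i + 1`, then the two factors for `H_i` trade places. Otherwise the rectangle
of height one from `x` to `y`, or the one from `y` to `x`, is moved across the annulus `H_i` by two
exchanges of factors, so that the signs cancel (`IsCocycle.annulus_eq`). The rows `i - 1` and `i`
need not be considered, as the other exchanges connect all generators. Reflection in the diagonal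
turns vertical annuli into horizontal ones (`vFun_eq_hFun_transpose`).

*Injectivity.* Let `F` be flat, with trivial values on the annuli. On rectangles of height one, `F`
is a function on the edges of the Cayley graph of the symmetric group for the `N` cyclically
adjacent transpositions, and it has trivial holonomy around the squares and around the hexagons of
the braid relations (`IsCocycle.hexagon`). Row by row, a gauge makes it trivial on all rows but the
last (`IsCocycle.exists_gauge_rows`). On the last row, what remains is a function of the two values
of the generator in the last and in the first row, and the hexagons and the vertical annuli show
that it is trivial (`IsCocycle.last_row_eq_one`). Finally, `L`-shapes reduce any rectangle to
rectangles of height one (`IsCocycle.eq_one_of_rows`).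

*Existence.* In the Clifford algebra with generators `γ_i`, the elements `γ_i - γ_j`, suitably
normalized, generate a double cover of the symmetric group: they are lifts of the transpositions,
and the only lifts of the identity are `1` and `-1` (`IsLift.eq_one_or_neg_one`). A rectangle from
`x` to `y` with rows `b` and `t` multiplies a lift of `x` by `γ_b - γ_t`; its sign compares the
result to a chosen lift of `y` (`spinSign`). The relation holds because the lifts of the
transpositions anticommute over each domain with two factorizations (`root_mul_root_of_chain`).

*Counting.* A sign assignment may be multiplied by any homomorphism from chains to signs, which
changes the values on the annuli by its values on them (`Decomposition.signProd_twist`). These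
values are arbitrary on all annuli but one (`exists_chainSign`), and so `Φ` is a bijection. -/

namespace Grid

/-! ### Arcs on the circle `ℤ/N` -/

section Arcs

variable {N : ℕ}

open Classical in
/-- The indicator function of the set of unit intervals that make up the arc from `a` to `b`. -/
noncomputable def arcIndicator (a b c : Fin N) : ℤ := if InArc a b c then 1 else 0

theorem arcIndicator_nonneg (a b c : Fin N) : 0 ≤ arcIndicator a b c := by
  unfold arcIndicator
  split_ifs <;> simp

theorem arcIndicator_left {a b : Fin N} (h : a ≠ b) : arcIndicator a b a = 1 :=
  if_pos (inArc_left h)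

theorem arcIndicator_swap {a b : Fin N} (h : a ≠ b) (c : Fin N) :
    arcIndicator a b c + arcIndicator b a c = 1 := by
  have := inArc_swap h c
  unfold arcIndicator
  split_ifs <;> simp_all

theorem inOpenArc_of_inArc {a b c : Fin N} (h : InArc a b c) (hc : c ≠ a) : InOpenArc a b c := by
  refine ⟨?_, h⟩
  have h' : c.val ≠ a.val := fun e => hc (Fin.ext e)
  have := a.isLt
  rw [val_sub_eq]
  split_ifs <;> omega

theorem inOpenArc_of_arcIndicator {a b c : Fin N} (h : arcIndicator a b c = 1) (hc : c ≠ a) :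
    InOpenArc a b c :=
  inOpenArc_of_inArc (by by_contra h'; simp [arcIndicator, h'] at h) hc

theorem InOpenArc.ne_left {a b c : Fin N} (h : InOpenArc a b c) : c ≠ a := by
  rintro rfl
  have := h.1
  rw [val_sub_eq] at this
  simp at this

theorem InOpenArc.ne_right {a b c : Fin N} (h : InOpenArc a b c) : c ≠ b := by
  rintro rfl
  exact lt_irrefl _ h.2

theorem InOpenArc.ne {a b c : Fin N} (h : InOpenArc a b c) : a ≠ b := by
  rintro rfl
  have := h.1.trans h.2
  rw [val_sub_eq] at this
  simp at this

theorem InOpenArc.rotate {a b c : Fin N} (h : InOpenArc a b c) : InOpenArc c a b := by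
  have ha := a.isLt
  have hb := b.isLt
  have hc := c.isLt
  unfold InOpenArc at *
  simp only [val_sub_eq] at *
  split_ifs at * <;> omega

/-- Of the two cyclic orders of three distinct points, exactly one holds. -/
theorem inOpenArc_total {a b c : Fin N} (hab : a ≠ b) (hac : a ≠ c) (hbc : b ≠ c) :
    InOpenArc a b c ∨ InOpenArc b a c := by
  by_cases h : InArc a b c
  · exact .inl (inOpenArc_of_inArc h hac.symm)
  · exact .inr (inOpenArc_of_inArc ((inArc_swap hab c).2 h) hbc.symm)

theorem InOpenArc.asymm {a b c : Fin N} (h : InOpenArc a b c) : ¬ InOpenArc b a c :=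
  fun h' => (inArc_swap h.ne c).1 h'.2 h.2

theorem arcIndicator_add {a b c : Fin N} (h : InOpenArc a b c) (d : Fin N) :
    arcIndicator a c d + arcIndicator c b d = arcIndicator a b d := by
  have ha := a.isLt
  have hb := b.isLt
  have hc := c.isLt
  have hd := d.isLt
  unfold InOpenArc at h
  unfold arcIndicator InArc
  simp only [val_sub_eq] at *
  split_ifs at * <;> omega

theorem InOpenArc.of_sub_left {a b c d : Fin N} (h : InOpenArc a b c) (hd : InOpenArc c b d) :
    InOpenArc a b d := by
  have ha := a.isLt
  have hb := b.isLt
  have hc := c.isLt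
  have hd := d.isLt
  unfold InOpenArc at *
  simp only [val_sub_eq] at *
  split_ifs at * <;> omega

theorem inOpenArc_add_one [N.AtLeastTwo] {a c : Fin N} (h : c ≠ a) (h' : c ≠ a + 1) :
    InOpenArc a c (a + 1) := by
  rcases inOpenArc_total h.symm (ne_add_one a) h' with h₀ | h₀
  · exact h₀
  · exact absurd h₀.rotate.rotate (not_inOpenArc_add_one _ _)

theorem inOpenArc_add_two [N.AtLeastTwo] {a c : Fin N} (h : InOpenArc a (a + 1 + 1) c) :
    c = a + 1 := by
  by_contra h'
  have h₀ : a + 1 + 1 ≠ a := h.ne.symm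
  have h₁ := arcIndicator_add (inOpenArc_add_one h₀ (ne_add_one (a + 1)).symm) c
  have h₂ : arcIndicator a (a + 1 + 1) c = 1 := if_pos h.2
  have h₃ : arcIndicator a (a + 1) c = 0 := if_neg fun e => h.ne_left (inArc_add_one.1 e)
  have h₄ : arcIndicator (a + 1) (a + 1 + 1) c = 0 := if_neg fun e => h' (inArc_add_one.1 e)
  omega

end Arcs

/-! ### Functions on rectangles in terms of rows -/

section Rows

variable {N : ℕ}

theorem Rectangle.chain_apply {x y : Generator N} (R : Rectangle x y) (col row : Fin N) :
    R.chain col row = arcIndicator R.left R.right col * arcIndicator R.bottom R.top row := by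
  unfold Rectangle.chain arcIndicator
  split_ifs <;> simp_all

/-- The rows `b` and `t` span a rectangle with source `x`: there is no coordinate of `x` in the
interior of the rectangle with bottom-left corner `(x b, b)` and top-right corner `(x t, t)`. -/
def Spans (x : Generator N) (b t : Fin N) : Prop :=
  b ≠ t ∧ ∀ i, ¬ (InOpenArc b t i ∧ InOpenArc (x b) (x t) (x i))

theorem Rectangle.spans {x y : Generator N} (R : Rectangle x y) : Spans x R.bottom R.top := by
  refine ⟨R.bottom_ne_top, fun i => ?_⟩
  rw [R.bottomLeft, R.topRight]
  exact R.empty_source i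

theorem Rectangle.target {x y : Generator N} (R : Rectangle x y) :
    y = x * Equiv.swap R.bottom R.top := by
  ext1 i
  rw [Equiv.Perm.mul_apply, Equiv.swap_apply_def]
  split_ifs with h₁ h₂
  · rw [h₁, R.bottomRight, R.topRight]
  · rw [h₂, R.topLeft, R.bottomLeft]
  · exact (R.agree i h₁ h₂).symm

/-- The rectangle with source `x` spanned by the rows `b` and `t`. -/
def Rectangle.ofRows (x : Generator N) (b t : Fin N) (h : Spans x b t) :
    Rectangle x (x * Equiv.swap b t) where
  left := x b
  right := x t
  bottom := b
  top := t
  left_ne_right := fun e => h.1 (x.injective e)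
  bottom_ne_top := h.1
  bottomLeft := rfl
  topRight := rfl
  topLeft := by simp
  bottomRight := by simp
  agree := fun k h₁ h₂ => by simp [Equiv.swap_apply_of_ne_of_ne h₁ h₂]
  empty_source := h.2
  empty_target := fun k hk => h.2 k (by
    rwa [Equiv.Perm.mul_apply, Equiv.swap_apply_of_ne_of_ne hk.1.ne_left hk.1.ne_right] at hk)

open Classical in
/-- A function on rectangles, as a function of the source and of the bottom and top rows; its value
is `1` where there is no rectangle. -/
noncomputable def onRows (f : ∀ x y : Generator N, Rectangle x y → ℤˣ) (x : Generator N)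
    (b t : Fin N) : ℤˣ :=
  if h : Spans x b t then f _ _ (Rectangle.ofRows x b t h) else 1

theorem onRows_eq (f : ∀ x y : Generator N, Rectangle x y → ℤˣ) {x y : Generator N}
    (R : Rectangle x y) : onRows f x R.bottom R.top = f x y R := by
  have key : ∀ (z : Generator N) (S : Rectangle x z), S.bottom = R.bottom → S.top = R.top →
      f x z S = f x y R := by
    intro z S hb ht
    obtain rfl := S.target_eq R hb ht
    rw [S.eq_of_rows R hb ht]
  rw [onRows, dif_pos R.spans]
  exact key _ _ rfl rfl

/-- A function of a source and two rows, regarded as a function on rectangles, such that the two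
factorizations of a domain into two rectangles have products that differ by the factor `ε`. -/
def IsCocycle (ε : ℤˣ) (F : Generator N → Fin N → Fin N → ℤˣ) : Prop :=
  ∀ (x : Generator N) (b₁ t₁ b₂ t₂ b₁' t₁' b₂' t₂' : Fin N),
    Spans x b₁ t₁ → Spans (x * Equiv.swap b₁ t₁) b₂ t₂ →
    Spans x b₁' t₁' → Spans (x * Equiv.swap b₁' t₁') b₂' t₂' →
    x * Equiv.swap b₁ t₁ * Equiv.swap b₂ t₂ = x * Equiv.swap b₁' t₁' * Equiv.swap b₂' t₂' →
    x * Equiv.swap b₁ t₁ * Equiv.swap b₂ t₂ ≠ x →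
    x * Equiv.swap b₁ t₁ ≠ x * Equiv.swap b₁' t₁' →
    (∀ col row,
      arcIndicator (x b₁) (x t₁) col * arcIndicator b₁ t₁ row +
        arcIndicator ((x * Equiv.swap b₁ t₁) b₂) ((x * Equiv.swap b₁ t₁) t₂) col *
          arcIndicator b₂ t₂ row =
      arcIndicator (x b₁') (x t₁') col * arcIndicator b₁' t₁' row +
        arcIndicator ((x * Equiv.swap b₁' t₁') b₂') ((x * Equiv.swap b₁' t₁') t₂') col *
          arcIndicator b₂' t₂' row) →
    F x b₁ t₁ * F (x * Equiv.swap b₁ t₁) b₂ t₂ =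
      ε * (F x b₁' t₁' * F (x * Equiv.swap b₁' t₁') b₂' t₂')

theorem mul_swap_ne {x : Generator N} {b t : Fin N} (h : b ≠ t) : x * Equiv.swap b t ≠ x := by
  intro e
  rw [mul_eq_left, Equiv.swap_eq_one_iff] at e
  exact h e

theorem SignAssignment.isCocycle (s : SignAssignment N) :
    IsCocycle (-1) (onRows fun _ _ R => s.sign R) := by
  intro x b₁ t₁ b₂ t₂ b₁' t₁' b₂' t₂' h₁ h₂ h₁' h₂' hy hyx hz hc
  obtain ⟨R₂', hR₂b, hR₂t⟩ : ∃ R : Rectangle (x * Equiv.swap b₁' t₁')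
      (x * Equiv.swap b₁ t₁ * Equiv.swap b₂ t₂), R.bottom = b₂' ∧ R.top = t₂' := by
    rw [hy]
    exact ⟨Rectangle.ofRows _ _ _ h₂', rfl, rfl⟩
  have := s.anticomm (x := x) hyx.symm (mul_swap_ne h₁.1).symm (mul_swap_ne h₁'.1).symm
    (mul_swap_ne h₂.1) (hy ▸ mul_swap_ne h₂'.1) hz (Rectangle.ofRows _ _ _ h₁)
    (Rectangle.ofRows _ _ _ h₂) (Rectangle.ofRows _ _ _ h₁') R₂' (by
      funext col row
      simp only [Pi.add_apply, Rectangle.chain_apply]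
      rw [← R₂'.bottomLeft, ← R₂'.topRight, hR₂b, hR₂t]
      exact hc col row)
  have e := onRows_eq (fun _ _ R => s.sign R) R₂'
  rw [hR₂b, hR₂t] at e
  rw [e, onRows, onRows, onRows, dif_pos h₁, dif_pos h₁', dif_pos h₂, this, neg_one_mul]

theorem IsCocycle.mul {ε₁ ε₂ : ℤˣ} {F₁ F₂ : Generator N → Fin N → Fin N → ℤˣ}
    (h₁ : IsCocycle ε₁ F₁) (h₂ : IsCocycle ε₂ F₂) :
    IsCocycle (ε₁ * ε₂) fun x b t => F₁ x b t * F₂ x b t := by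
  intro x b₁ t₁ b₂ t₂ b₁' t₁' b₂' t₂' a₁ a₂ a₃ a₄ a₅ a₆ a₇ a₈
  have e₁ := h₁ x b₁ t₁ b₂ t₂ b₁' t₁' b₂' t₂' a₁ a₂ a₃ a₄ a₅ a₆ a₇ a₈
  have e₂ := h₂ x b₁ t₁ b₂ t₂ b₁' t₁' b₂' t₂' a₁ a₂ a₃ a₄ a₅ a₆ a₇ a₈
  simp only
  rw [mul_mul_mul_comm, e₁, e₂]
  ac_rfl

theorem IsCocycle.gauge {ε : ℤˣ} {F : Generator N → Fin N → Fin N → ℤˣ} (h : IsCocycle ε F)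
    (g : Generator N → ℤˣ) :
    IsCocycle ε fun x b t => g x * g (x * Equiv.swap b t) * F x b t := by
  intro x b₁ t₁ b₂ t₂ b₁' t₁' b₂' t₂' a₁ a₂ a₃ a₄ a₅ a₆ a₇ a₈
  have e := h x b₁ t₁ b₂ t₂ b₁' t₁' b₂' t₂' a₁ a₂ a₃ a₄ a₅ a₆ a₇ a₈
  have key : ∀ p q r u v : ℤˣ, p * q * u * (q * r * v) = p * r * (u * v) := by decide
  simp only
  rw [key, key, e, a₅]
  ac_rfl

end Rows

/-! ### Disjoint rectangles and `L`-shapes -/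

section LShapes

variable {N : ℕ} {ε : ℤˣ} {F : Generator N → Fin N → Fin N → ℤˣ}

theorem spans_add_one [N.AtLeastTwo] (x : Generator N) (a : Fin N) : Spans x a (a + 1) :=
  ⟨ne_add_one a, fun _ h => not_inOpenArc_add_one a _ h.1⟩

theorem spans_add_two [N.AtLeastTwo] {x : Generator N} {a : Fin N} (h : a ≠ a + 1 + 1)
    (hx : ¬ InOpenArc (x a) (x (a + 1 + 1)) (x (a + 1))) : Spans x a (a + 1 + 1) :=
  ⟨h, fun _ hi => hx (inOpenArc_add_two hi.1 ▸ hi.2)⟩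

/-- Two rectangles of height one without common rows. -/
theorem IsCocycle.disjoint [N.AtLeastTwo] (hF : IsCocycle ε F) (x : Generator N) {a b : Fin N}
    (hab : a ≠ b) (h₁ : a + 1 ≠ b) (h₂ : b + 1 ≠ a) :
    F x a (a + 1) * F (x * Equiv.swap a (a + 1)) b (b + 1) =
      ε * (F x b (b + 1) * F (x * Equiv.swap b (b + 1)) a (a + 1)) := by
  have ha := ne_add_one a
  have hb := ne_add_one b
  have h₃ : a + 1 ≠ b + 1 := fun e => hab (add_right_cancel e)
  refine hF x _ _ _ _ _ _ _ _ (spans_add_one _ _) (spans_add_one _ _) (spans_add_one _ _)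
    (spans_add_one _ _) ?_ ?_ ?_ ?_
  · rw [mul_assoc, mul_assoc, Equiv.mul_swap_eq_swap_mul (Equiv.swap a (a + 1)),
      Equiv.swap_apply_of_ne_of_ne hab.symm h₁.symm, Equiv.swap_apply_of_ne_of_ne h₂ h₃.symm]
  · intro e
    have := Equiv.congr_fun e a
    simp only [Equiv.Perm.mul_apply, Equiv.swap_apply_of_ne_of_ne hab h₂.symm,
      Equiv.swap_apply_left] at this
    exact ha (x.injective this).symm
  · intro e
    have := Equiv.congr_fun e a
    simp only [Equiv.Perm.mul_apply, Equiv.swap_apply_of_ne_of_ne hab h₂.symm,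
      Equiv.swap_apply_left] at this
    exact ha (x.injective this).symm
  · intro col row
    simp only [Equiv.Perm.mul_apply, Equiv.swap_apply_of_ne_of_ne hab h₂.symm,
      Equiv.swap_apply_of_ne_of_ne h₁ h₃, Equiv.swap_apply_of_ne_of_ne hab.symm h₁.symm,
      Equiv.swap_apply_of_ne_of_ne h₂ h₃.symm]
    ring

/-- An `L`-shape lies in two consecutive strips of rows, from `a` to `b` and from `b` to `c`, and in
two consecutive strips of columns, and misses one corner. It is cut into two rectangles at its
reflex corner, horizontally or vertically. This is the `L`-shape without its top-right corner. -/
theorem IsCocycle.missing_topRight (hF : IsCocycle ε F) {x : Generator N} {a b c : Fin N}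
    (hr : InOpenArc a c b) (hx : InOpenArc (x a) (x b) (x c))
    (h₁ : Spans x a b) (h₂ : Spans (x * Equiv.swap a b) b c)
    (h₃ : Spans x a c) (h₄ : Spans (x * Equiv.swap a c) a b) :
    F x a b * F (x * Equiv.swap a b) b c = ε * (F x a c * F (x * Equiv.swap a c) a b) := by
  have hba := hr.ne_left
  have hbc := hr.ne_right
  have hac := hr.ne
  refine hF x _ _ _ _ _ _ _ _ h₁ h₂ h₃ h₄ ?_ ?_ ?_ ?_
  · rw [mul_assoc, mul_assoc, Equiv.mul_swap_eq_swap_mul (Equiv.swap a b)]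
    simp [Equiv.swap_apply_of_ne_of_ne hac.symm hbc.symm]
  · intro e
    have := Equiv.congr_fun e a
    simp [Equiv.swap_apply_of_ne_of_ne hba.symm hac] at this
    exact hba this
  · intro e
    have := Equiv.congr_fun e a
    simp at this
    exact hbc this
  · intro col row
    simp [Equiv.swap_apply_of_ne_of_ne hac.symm hbc.symm, Equiv.swap_apply_of_ne_of_ne hba hbc]
    rw [← arcIndicator_add hr, ← arcIndicator_add hx]
    ring

/-- The `L`-shape without its top-left corner. -/
theorem IsCocycle.missing_topLeft (hF : IsCocycle ε F) {x : Generator N} {a b c : Fin N}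
    (hr : InOpenArc a c b) (hx : InOpenArc (x a) (x c) (x b))
    (h₁ : Spans x a b) (h₂ : Spans (x * Equiv.swap a b) a c)
    (h₃ : Spans x b c) (h₄ : Spans (x * Equiv.swap b c) a b) :
    F x a b * F (x * Equiv.swap a b) a c = ε * (F x b c * F (x * Equiv.swap b c) a b) := by
  have hba := hr.ne_left
  have hbc := hr.ne_right
  have hac := hr.ne
  refine hF x _ _ _ _ _ _ _ _ h₁ h₂ h₃ h₄ ?_ ?_ ?_ ?_
  · rw [mul_assoc, mul_assoc, Equiv.mul_swap_eq_swap_mul (Equiv.swap a b)]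
    simp [Equiv.swap_apply_of_ne_of_ne hac.symm hbc.symm]
  · intro e
    have := Equiv.congr_fun e a
    simp [Equiv.swap_apply_of_ne_of_ne hac.symm hbc.symm] at this
    exact hac this.symm
  · intro e
    have := Equiv.congr_fun e a
    simp [Equiv.swap_apply_of_ne_of_ne hba.symm hac] at this
    exact hba this
  · intro col row
    simp [Equiv.swap_apply_of_ne_of_ne hac.symm hbc.symm, Equiv.swap_apply_of_ne_of_ne hba.symm hac]
    rw [← arcIndicator_add hr, ← arcIndicator_add hx]
    ring

/-- The `L`-shape without its bottom-right corner. -/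
theorem IsCocycle.missing_bottomRight (hF : IsCocycle ε F) {x : Generator N} {a b c : Fin N}
    (hr : InOpenArc a c b) (hx : InOpenArc (x a) (x c) (x b))
    (h₁ : Spans x a b) (h₂ : Spans (x * Equiv.swap a b) b c)
    (h₃ : Spans x b c) (h₄ : Spans (x * Equiv.swap b c) a c) :
    F x a b * F (x * Equiv.swap a b) b c = ε * (F x b c * F (x * Equiv.swap b c) a c) := by
  have hba := hr.ne_left
  have hbc := hr.ne_right
  have hac := hr.ne
  refine hF x _ _ _ _ _ _ _ _ h₁ h₂ h₃ h₄ ?_ ?_ ?_ ?_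
  · rw [mul_assoc, mul_assoc, Equiv.mul_swap_eq_swap_mul (Equiv.swap b c),
      Equiv.swap_apply_of_ne_of_ne hba.symm hac, Equiv.swap_apply_right]
  · intro e
    have := Equiv.congr_fun e a
    simp [Equiv.swap_apply_of_ne_of_ne hba.symm hac] at this
    exact hba this
  · intro e
    have := Equiv.congr_fun e a
    simp [Equiv.swap_apply_of_ne_of_ne hba.symm hac] at this
    exact hba this
  · intro col row
    simp [Equiv.swap_apply_of_ne_of_ne hac.symm hbc.symm, Equiv.swap_apply_of_ne_of_ne hba.symm hac]
    rw [← arcIndicator_add hr, ← arcIndicator_add hx]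
    ring

end LShapes

/-! ### Functions invariant under exchanges of adjacent rows -/

section Invariance

variable {N : ℕ}

theorem swap_mul_swap_left {a b c : Fin N} (hac : a ≠ c) (hbc : b ≠ c) :
    Equiv.swap a b * Equiv.swap a c = Equiv.swap b c * Equiv.swap a b := by
  rw [Equiv.mul_swap_eq_swap_mul, Equiv.swap_apply_left,
    Equiv.swap_apply_of_ne_of_ne hac.symm hbc.symm]

theorem swap_mul_swap_middle {a b c : Fin N} (hac : a ≠ c) (hbc : b ≠ c) :
    Equiv.swap a b * Equiv.swap b c = Equiv.swap a c * Equiv.swap a b := by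
  rw [Equiv.mul_swap_eq_swap_mul, Equiv.swap_apply_right,
    Equiv.swap_apply_of_ne_of_ne hac.symm hbc.symm]

theorem swap_invariant_trans {α : Type*} {ψ : Generator N → α} {p q r : Fin N}
    (h₁ : ∀ u, ψ (u * Equiv.swap p q) = ψ u) (h₂ : ∀ u, ψ (u * Equiv.swap q r) = ψ u)
    (u : Generator N) : ψ (u * Equiv.swap p r) = ψ u := by
  by_cases hpq : p = q
  · rw [hpq, h₂]
  by_cases hpr : p = r
  · rw [hpr, Equiv.swap_self, ← Equiv.Perm.one_def, mul_one]
  rw [Equiv.swap_comm p r, ← Equiv.swap_mul_swap_mul_swap hpq hpr, ← mul_assoc, ← mul_assoc, h₂, h₁,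
    h₂]

theorem eq_of_swap_invariant {α : Type*} {ψ : Generator N → α} {x y : Generator N}
    (h : ∀ p q, x p ≠ y p → x q ≠ y q → ∀ u, ψ (u * Equiv.swap p q) = ψ u) : ψ x = ψ y := by
  induction hn : (Finset.univ.filter fun p => x p ≠ y p).card using Nat.strong_induction_on
    generalizing x with
  | _ n ih =>
    by_cases hxy : x = y
    · rw [hxy]
    obtain ⟨p, hp⟩ : ∃ p, x p ≠ y p := by
      by_contra! h'
      exact hxy (Equiv.ext h')
    -- The row `q` of `x` holds the value that `y` has in the row `p`.
    obtain ⟨q, hq⟩ := x.surjective (y p)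
    have hqp : q ≠ p := fun e => hp (e ▸ hq)
    have hxq : x q ≠ y q := fun e => hqp (y.injective (e.symm.trans hq))
    have hsub : ∀ r, (x * Equiv.swap p q) r ≠ y r → x r ≠ y r := by
      intro r hr
      by_cases h₁ : r = p
      · rwa [h₁]
      by_cases h₂ : r = q
      · rwa [h₂]
      rwa [Equiv.Perm.mul_apply, Equiv.swap_apply_of_ne_of_ne h₁ h₂] at hr
    rw [← h p q hp hxq x]
    refine ih _ ?_ (fun a b ha hb => h a b (hsub a ha) (hsub b hb)) rfl
    rw [← hn]
    refine Finset.card_lt_card ⟨fun r hr => ?_, fun hs => ?_⟩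
    · simp only [Finset.mem_filter, Finset.mem_univ, true_and] at hr ⊢
      exact hsub r hr
    · have := hs (Finset.mem_filter.2 ⟨Finset.mem_univ p, hp⟩)
      exact (Finset.mem_filter.1 this).2 (by simp [hq])

/-- If a function on generators is invariant under the exchange of adjacent rows in the interval `T`
of rows that starts at `a`, then its value depends only on the rows outside `T`. -/
theorem eq_of_adjacent_invariant [N.AtLeastTwo] {α : Type*} {ψ : Generator N → α}
    (T : Fin N → Prop) (a : Fin N)
    (h : ∀ c, T (c + 1) → c + 1 ≠ a → T c ∧ ∀ u, ψ (u * Equiv.swap c (c + 1)) = ψ u)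
    {x y : Generator N} (hxy : ∀ i, ¬ T i → x i = y i) : ψ x = ψ y := by
  have key : ∀ (n : ℕ) (j : Fin N), (j - a).val = n → T j →
      ∀ u, ψ (u * Equiv.swap a j) = ψ u := by
    intro n
    induction n with
    | zero =>
      intro j hj _ u
      have : j = a := by
        have h₁ := j.isLt
        have h₂ := a.isLt
        rw [val_sub_eq] at hj
        ext
        split_ifs at hj <;> omega
      rw [this, Equiv.swap_self, ← Equiv.Perm.one_def, mul_one]
    | succ n ih =>
      intro j hj hT
      obtain ⟨c, rfl⟩ : ∃ c, c + 1 = j := ⟨j - 1, sub_add_cancel j 1⟩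
      have hca : c + 1 ≠ a := by
        intro e
        rw [e, val_sub_eq] at hj
        simp at hj
      obtain ⟨hTc, hc⟩ := h c hT hca
      refine swap_invariant_trans (ih c ?_ hTc) hc
      have h₁ := c.isLt
      have h₂ := a.isLt
      have h₃ : (c + 1).val ≠ a.val := fun e => hca (Fin.ext e)
      rw [val_sub_eq, val_add_one_eq] at hj
      rw [val_add_one_eq] at h₃
      rw [val_sub_eq]
      split_ifs at * <;> omega
  refine eq_of_swap_invariant fun p q hp hq => ?_
  have hp' : T p := by_contra fun e => hp (hxy p e)
  have hq' : T q := by_contra fun e => hq (hxy q e)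
  refine swap_invariant_trans (q := a) (fun u => ?_) (key _ q rfl hq')
  rw [Equiv.swap_comm, key _ p rfl hp']

end Invariance

/-! ### Independence of the generator: horizontal annuli -/

section Annuli

variable {N : ℕ} [N.AtLeastTwo] {ε : ℤˣ} {F : Generator N → Fin N → Fin N → ℤˣ}

/-- A rectangle of height one in the row `a + 1` is moved across the annulus `H_a`, from its end to
its start, by two exchanges of factors. -/
theorem IsCocycle.annulus_of_order (hF : IsCocycle ε F) {x : Generator N} {a : Fin N}
    (ha : a + 1 + 1 ≠ a) (hx : InOpenArc (x a) (x (a + 1 + 1)) (x (a + 1))) :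
    F (x * Equiv.swap (a + 1) (a + 1 + 1)) a (a + 1) *
        F (x * Equiv.swap (a + 1) (a + 1 + 1) * Equiv.swap a (a + 1)) a (a + 1) =
      F x a (a + 1) * F (x * Equiv.swap a (a + 1)) a (a + 1) := by
  have hab := ne_add_one a
  have hbc := ne_add_one (a + 1)
  have hr : InOpenArc a (a + 1 + 1) (a + 1) := inOpenArc_add_one ha hbc.symm
  have hz : (x * Equiv.swap a (a + 1)) (a + 1 + 1) = x (a + 1 + 1) := by
    rw [Equiv.Perm.mul_apply, Equiv.swap_apply_of_ne_of_ne ha hbc.symm]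
  have hs : Spans (x * Equiv.swap a (a + 1)) a (a + 1 + 1) := by
    refine spans_add_two ha.symm ?_
    rw [hz]
    simpa using fun h => hx.asymm (InOpenArc.rotate (InOpenArc.rotate h))
  have e₁ := hF.missing_topRight (x := x * Equiv.swap a (a + 1)) hr
    (by rw [hz]; simpa using hx.rotate) (spans_add_one _ _) (spans_add_one _ _) hs
    (spans_add_one _ _)
  have e₂ := hF.missing_topLeft hr hx (spans_add_one _ _) hs (spans_add_one _ _)
    (spans_add_one _ _)
  rw [mul_assoc x, Equiv.swap_mul_self, mul_one, mul_assoc x, swap_mul_swap_left ha.symm hbc,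
    ← mul_assoc x] at e₁
  have key : ∀ ε A B R S T U : ℤˣ, B * R = ε * (S * T) → A * S = ε * (R * U) → U * T = A * B := by
    decide
  exact key _ _ _ _ _ _ _ e₁ e₂

/-- The product of the values on the two rectangles of a horizontal annulus does not depend on the
generator. -/
theorem IsCocycle.annulus_eq (hF : IsCocycle ε F) (x y : Generator N) (a : Fin N) :
    F x a (a + 1) * F (x * Equiv.swap a (a + 1)) a (a + 1) =
      F y a (a + 1) * F (y * Equiv.swap a (a + 1)) a (a + 1) := by
  refine eq_of_adjacent_invariant
    (ψ := fun x => F x a (a + 1) * F (x * Equiv.swap a (a + 1)) a (a + 1))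
    (fun _ => True) a (fun c _ hca => ⟨trivial, fun u => ?_⟩) fun i hi => absurd trivial hi
  by_cases h₁ : c = a
  · rw [h₁, mul_assoc u, Equiv.swap_mul_self, mul_one, mul_comm]
  by_cases h₂ : c = a + 1
  · subst h₂
    have hbc := ne_add_one (a + 1)
    rcases inOpenArc_total (u.injective.ne hca.symm) (u.injective.ne (ne_add_one a))
      (u.injective.ne hbc.symm) with h | h
    · exact hF.annulus_of_order hca h
    · have e := hF.annulus_of_order (x := u * Equiv.swap (a + 1) (a + 1 + 1)) hca (by
        rw [Equiv.Perm.mul_apply, Equiv.swap_apply_of_ne_of_ne (ne_add_one a) hca.symm]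
        simpa using h.rotate.rotate)
      rw [mul_assoc u (Equiv.swap (a + 1) _), Equiv.swap_mul_self, mul_one] at e
      exact e.symm
  have e₁ := hF.disjoint u (Ne.symm h₁) (Ne.symm h₂) hca
  have e₂ := hF.disjoint (u * Equiv.swap a (a + 1)) (Ne.symm h₁) (Ne.symm h₂) hca
  have hc : Equiv.swap a (a + 1) * Equiv.swap c (c + 1) =
      Equiv.swap c (c + 1) * Equiv.swap a (a + 1) := by
    rw [Equiv.mul_swap_eq_swap_mul, Equiv.swap_apply_of_ne_of_ne h₁ h₂,
      Equiv.swap_apply_of_ne_of_ne hca fun e => h₁ (add_right_cancel e)]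
  rw [mul_assoc u, mul_assoc u, Equiv.swap_mul_self, mul_one, hc, ← mul_assoc u] at e₂
  have key : ∀ ε A B R S T U : ℤˣ, A * S = ε * (R * T) → B * R = ε * (S * U) → T * U = A * B := by
    decide
  exact key _ _ _ _ _ _ _ e₁ e₂

theorem hFun_eq (s : SignAssignment N) (x : Generator N) (i : Fin N) :
    hFun s x i = onRows (fun _ _ R => s.sign R) x i (i + 1) *
      onRows (fun _ _ R => s.sign R) (x * Equiv.swap i (i + 1)) i (i + 1) :=
  (congrArg₂ (· * ·) (onRows_eq (fun _ _ R => s.sign R) (horizontalDecomposition x i).fst)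
    (onRows_eq (fun _ _ R => s.sign R) (horizontalDecomposition x i).snd)).symm

theorem vFun_eq (s : SignAssignment N) (x : Generator N) (j : Fin N) :
    vFun s x j = onRows (fun _ _ R => s.sign R) x (x.symm j) (x.symm (j + 1)) *
      onRows (fun _ _ R => s.sign R) (x * Equiv.swap (x.symm j) (x.symm (j + 1)))
        (x.symm (j + 1)) (x.symm j) :=
  (congrArg₂ (· * ·) (onRows_eq (fun _ _ R => s.sign R) (verticalDecomposition x j).fst)
    (onRows_eq (fun _ _ R => s.sign R) (verticalDecomposition x j).snd)).symm

end Annuli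

/-! ### Reflection in the diagonal and vertical annuli -/

section Transpose

variable {N : ℕ}

/-- The reflection in the diagonal, which exchanges the roles of the two families of circles. It
keeps the source and the target of a rectangle. -/
def Rectangle.transpose {x y : Generator N} (R : Rectangle x y) : Rectangle x⁻¹ y⁻¹ where
  left := R.bottom
  right := R.top
  bottom := R.left
  top := R.right
  left_ne_right := R.bottom_ne_top
  bottom_ne_top := R.left_ne_right
  bottomLeft := by rw [Equiv.Perm.inv_eq_iff_eq, R.bottomLeft]
  topRight := by rw [Equiv.Perm.inv_eq_iff_eq, R.topRight]
  topLeft := by rw [Equiv.Perm.inv_eq_iff_eq, R.bottomRight]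
  bottomRight := by rw [Equiv.Perm.inv_eq_iff_eq, R.topLeft]
  agree := fun i h₁ h₂ => by
    obtain ⟨j, rfl⟩ := x.surjective i
    have e := R.agree j (fun e => h₁ (by rw [e, R.bottomLeft])) fun e => h₂ (by rw [e, R.topRight])
    rw [show x⁻¹ (x j) = j by simp, e]
    simp
  empty_source := fun i h => R.empty_source (x⁻¹ i) (by simpa using h.symm)
  empty_target := fun i h => R.empty_target (y⁻¹ i) (by simpa using h.symm)

theorem Rectangle.transpose_chain {x y : Generator N} (R : Rectangle x y) (col row : Fin N) :
    R.transpose.chain col row = R.chain row col := by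
  rw [Rectangle.chain_apply, Rectangle.chain_apply, mul_comm]
  rfl

/-- The sign assignment obtained by reflection in the diagonal. -/
def SignAssignment.transpose (s : SignAssignment N) : SignAssignment N where
  sign R := s.sign R.transpose
  anticomm h₁ h₂ h₃ h₄ h₅ h₆ R₁ R₂ R₁' R₂' h := by
    refine s.anticomm (inv_injective.ne h₁) (inv_injective.ne h₂) (inv_injective.ne h₃)
      (inv_injective.ne h₄) (inv_injective.ne h₅) (inv_injective.ne h₆) _ _ _ _ ?_
    funext col row
    simp only [Pi.add_apply, Rectangle.transpose_chain]
    exact congrFun (congrFun h row) col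

theorem vFun_eq_hFun_transpose [N.AtLeastTwo] (s : SignAssignment N) (x : Generator N)
    (j : Fin N) : vFun s x j = hFun s.transpose x⁻¹ j := by
  have h₁ := onRows_eq (fun _ _ R => s.sign R) (horizontalDecomposition x⁻¹ j).fst.transpose
  have h₂ := onRows_eq (fun _ _ R => s.sign R) (horizontalDecomposition x⁻¹ j).snd.transpose
  refine Eq.trans ?_ (congrArg₂ (· * ·) h₁ h₂)
  rw [vFun_eq]
  have hm : (horizontalDecomposition x⁻¹ j).mid⁻¹ =
      x * Equiv.swap (x.symm j) (x.symm (j + 1)) := by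
    rw [Equiv.mul_swap_eq_swap_mul]
    simp [horizontalDecomposition]
  rw [← hm]
  rfl

end Transpose

theorem hFun_independent {N : ℕ} [N.AtLeastTwo] (s : SignAssignment N) (x y : Generator N)
    (i : Fin N) : hFun s x i = hFun s y i := by
  rw [hFun_eq, hFun_eq]
  exact s.isCocycle.annulus_eq x y i

theorem vFun_independent {N : ℕ} [N.AtLeastTwo] (s : SignAssignment N) (x y : Generator N)
    (j : Fin N) : vFun s x j = vFun s y j := by
  rw [vFun_eq_hFun_transpose, vFun_eq_hFun_transpose]
  exact hFun_independent _ _ _ _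

/-! ### Hexagons -/

section Flat

variable {N : ℕ} [N.AtLeastTwo] {F : Generator N → Fin N → Fin N → ℤˣ}

/-- The values around a hexagon of the braid relation, for one of the two cyclic orders of the
columns. The two paths bound the same domain, and two exchanges of factors lead from one to the
other. -/
theorem IsCocycle.hexagon_of_order (hF : IsCocycle 1 F) {x : Generator N} {a b c : Fin N}
    (hb : a + 1 = b) (hc : b + 1 = c) (hca : c ≠ a) (hx : InOpenArc (x a) (x c) (x b)) :
    F x a b * F (x * Equiv.swap a b) b c * F (x * Equiv.swap a b * Equiv.swap b c) a b =
      F x b c * F (x * Equiv.swap b c) a b * F (x * Equiv.swap b c * Equiv.swap a b) b c := by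
  subst hb hc
  have hab := ne_add_one a
  have hbc := ne_add_one (a + 1)
  have hr : InOpenArc a (a + 1 + 1) (a + 1) := inOpenArc_add_one hca hbc.symm
  have hs : Spans (x * Equiv.swap (a + 1) (a + 1 + 1)) a (a + 1 + 1) := by
    refine spans_add_two hca.symm ?_
    rw [Equiv.Perm.mul_apply, Equiv.swap_apply_of_ne_of_ne hab hca.symm]
    simpa using fun h => hx.asymm (InOpenArc.rotate h)
  have e₁ := hF.missing_bottomRight hr hx (spans_add_one _ _) (spans_add_one _ _)
    (spans_add_one _ _) hs
  have e₂ := hF.missing_topRight (x := x * Equiv.swap (a + 1) (a + 1 + 1)) hr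
    (by
      rw [Equiv.Perm.mul_apply, Equiv.swap_apply_of_ne_of_ne hab hca.symm]
      simpa using hx)
    (spans_add_one _ _) (spans_add_one _ _) hs (spans_add_one _ _)
  have hp : x * Equiv.swap (a + 1) (a + 1 + 1) * Equiv.swap a (a + 1 + 1) =
      x * Equiv.swap a (a + 1) * Equiv.swap (a + 1) (a + 1 + 1) := by
    rw [mul_assoc, mul_assoc, Equiv.mul_swap_eq_swap_mul (Equiv.swap (a + 1) _),
      Equiv.swap_apply_of_ne_of_ne hab hca.symm, Equiv.swap_apply_right]
  rw [hp, one_mul] at e₂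
  rw [one_mul] at e₁
  rw [e₁, mul_assoc (F x _ _), ← e₂, ← mul_assoc (F x _ _)]

/-- The values around a hexagon of the braid relation. -/
theorem IsCocycle.hexagon (hF : IsCocycle 1 F)
    (hinv : ∀ x a, F (x * Equiv.swap a (a + 1)) a (a + 1) = F x a (a + 1)) (x : Generator N)
    {a b c : Fin N} (hb : a + 1 = b) (hc : b + 1 = c) (hca : c ≠ a) :
    F x a b * F (x * Equiv.swap a b) b c * F (x * Equiv.swap a b * Equiv.swap b c) a b =
      F x b c * F (x * Equiv.swap b c) a b * F (x * Equiv.swap b c * Equiv.swap a b) b c := by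
  have hab : a ≠ b := hb ▸ ne_add_one a
  have hbc : b ≠ c := hc ▸ ne_add_one b
  rcases inOpenArc_total (x.injective.ne hca.symm) (x.injective.ne hab) (x.injective.ne hbc.symm)
    with h | h
  · exact hF.hexagon_of_order hb hc hca h
  -- The neighbouring vertex of the same hexagon has the other cyclic order.
  · have e := hF.hexagon_of_order (x := x * Equiv.swap a b) hb hc hca (by
      rw [Equiv.Perm.mul_apply x, Equiv.Perm.mul_apply x, Equiv.Perm.mul_apply x,
        Equiv.swap_apply_of_ne_of_ne hca hbc.symm, Equiv.swap_apply_left, Equiv.swap_apply_right]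
      exact h.rotate)
    have hp : x * Equiv.swap a b * Equiv.swap b c * Equiv.swap a b =
        x * Equiv.swap b c * Equiv.swap a b * Equiv.swap b c := by
      rw [mul_assoc x, mul_assoc x, mul_assoc x, mul_assoc x,
        Equiv.swap_mul_swap_mul_swap hab hca.symm, Equiv.swap_comm a b, Equiv.swap_comm b c,
        Equiv.swap_mul_swap_mul_swap hbc.symm hca,
        Equiv.swap_comm]
    have i₁ := hinv x a
    have i₂ := hinv (x * Equiv.swap b c * Equiv.swap a b) b
    rw [hb] at i₁
    rw [hc] at i₂
    rw [hp, i₁, i₂, mul_assoc x, Equiv.swap_mul_self, mul_one] at e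
    have key : ∀ A B C D E G : ℤˣ, A * B * C = D * E * G → A * D * E = B * C * G := by decide
    exact key _ _ _ _ _ _ e

end Flat

/-! ### Reduction to rectangles of height one -/

section Height

variable {N : ℕ} {F : Generator N → Fin N → Fin N → ℤˣ}

theorem InArc.of_sub_left {a b c d : Fin N} (h : InOpenArc a b c) (hd : InArc c b d) :
    InArc a b d := by
  have ha := a.isLt
  have hb := b.isLt
  have hc := c.isLt
  have hd := d.isLt
  unfold InOpenArc at *
  unfold InArc at *
  simp only [val_sub_eq] at *
  split_ifs at * <;> omega

/-- The value on a rectangle of height at least two is determined by the values on rectangles of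
smaller height in the same rows: remove the bottom row with an `L`-shape. -/
theorem IsCocycle.eq_one_of_rows [N.AtLeastTwo] (hF : IsCocycle 1 F) {x : Generator N} {b t : Fin N}
    (hs : Spans x b t) (h : ∀ y c, InArc b t c → F y c (c + 1) = 1) : F x b t = 1 := by
  induction hn : (t - b).val using Nat.strong_induction_on generalizing x b with
  | _ n ih =>
    by_cases hbt : t = b + 1
    · rw [hbt]
      exact h x b (inArc_left hs.1)
    have hr := inOpenArc_add_one hs.1.symm hbt
    have hx : InOpenArc (x b) (x (b + 1)) (x t) := by
      rcases inOpenArc_total (x.injective.ne hs.1) (x.injective.ne (ne_add_one b))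
        (x.injective.ne hbt) with h' | h'
      · exact absurd ⟨hr, h'⟩ (hs.2 _)
      · exact h'.rotate.rotate
    have hs' : Spans (x * Equiv.swap b (b + 1)) (b + 1) t := by
      refine ⟨Ne.symm hbt, fun i hi => hs.2 i ⟨hr.of_sub_left hi.1, ?_⟩⟩
      have hi₂ := hi.2
      rw [Equiv.Perm.mul_apply x, Equiv.Perm.mul_apply x, Equiv.Perm.mul_apply x,
        Equiv.swap_apply_right, Equiv.swap_apply_of_ne_of_ne hs.1.symm hbt,
        Equiv.swap_apply_of_ne_of_ne (hr.of_sub_left hi.1).ne_left hi.1.ne_left] at hi₂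
      exact hi₂
    have e := hF.missing_topRight hr hx (spans_add_one _ _) hs' hs (spans_add_one _ _)
    rw [h _ b (inArc_left hs.1), h _ b (inArc_left hs.1), one_mul, one_mul, mul_one] at e
    rw [← e]
    refine ih _ ?_ hs' (fun y c hc => h y c (hc.of_sub_left hr)) rfl
    rw [← hn]
    have h₁ := b.isLt
    have h₂ := t.isLt
    have h₃ : t.val ≠ (b + 1).val := fun e => hbt (Fin.ext e)
    have h₄ : b.val ≠ t.val := fun e => hs.1 (Fin.ext e)
    rw [val_add_one_eq] at h₃
    simp only [val_sub_eq, val_add_one_eq]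
    split_ifs at * <;> omega

end Height

/-! ### Trivialization on all rows but the last -/

section Gauge

variable {N : ℕ} [N.AtLeastTwo] {F : Generator N → Fin N → Fin N → ℤˣ}

/-- If a flat function is trivial on the rows below `m`, then a gauge that is constant on the cosets
of the permutations of these rows makes it trivial on the row `m` as well. -/
theorem IsCocycle.exists_gauge_row (hF : IsCocycle 1 F)
    (hinv : ∀ x a, F (x * Equiv.swap a (a + 1)) a (a + 1) = F x a (a + 1)) (m : Fin N)
    (hm : m.val + 1 < N) (htriv : ∀ x a, a < m → F x a (a + 1) = 1) :
    ∃ g : Generator N → ℤˣ, ∀ x a, a ≤ m → F x a (a + 1) = g x * g (x * Equiv.swap a (a + 1)) := by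
  set ψ : Generator N → ℤˣ := fun x => F x m (m + 1) with hψ
  have hm1 : (m + 1).val = m.val + 1 := by
    rw [val_add_one_eq, if_neg (by omega)]
  have hmm : m < m + 1 := by rw [Fin.lt_def]; omega
  have hsucc : ∀ a : Fin N, a < m → (a + 1).val = a.val + 1 := fun a ha => by
    rw [Fin.lt_def] at ha
    rw [val_add_one_eq, if_neg (by omega)]
  -- The values on the row `m` depend only on the rows from `m` on.
  have hagree : ∀ {x y : Generator N}, (∀ i, m ≤ i → x i = y i) → ψ x = ψ y := by
    intro x y hxy
    refine eq_of_adjacent_invariant (fun i => i < m) 0 (fun c hc hc0 => ?_)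
      fun i hi => hxy i (not_lt.1 hi)
    have hc' : c.val + 1 < m.val := by
      have : (c + 1).val ≠ 0 := fun e => hc0 (Fin.ext e)
      rw [Fin.lt_def] at hc
      rw [val_add_one_eq] at this hc
      split_ifs at this hc <;> omega
    have hcm : c < m := by rw [Fin.lt_def]; omega
    refine ⟨hcm, fun u => ?_⟩
    have e := hF.disjoint u hcm.ne hc.ne (by rw [Ne, Fin.ext_iff]; omega)
    rwa [htriv _ _ hcm, htriv _ _ hcm, one_mul, one_mul, mul_one] at e
  have hψs : ∀ x, ψ (x * Equiv.swap m (m + 1)) = ψ x := fun x => hinv x m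
  -- A value `p₀ x` that `x` takes in one of the rows up to `m + 1`, chosen so that it depends only
  -- on the rows after `m + 1`.
  obtain ⟨p₀, hp₀, hp₀'⟩ : ∃ p₀ : Generator N → Fin N,
      (∀ x : Generator N, x.symm (p₀ x) ≤ m + 1) ∧
        ∀ x y, (∀ i, m + 1 < i → x i = y i) → p₀ x = p₀ y := by
    let tail : Generator N → {i : Fin N // m + 1 < i} → Fin N := fun x i => x i
    refine ⟨fun x => Function.invFun tail (tail x) 0, fun x => ?_, fun x y hxy => ?_⟩
    · by_contra hlt
      rw [not_le] at hlt
      have h₁ : tail (Function.invFun tail (tail x)) = tail x := Function.invFun_eq ⟨x, rfl⟩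
      have h₂ := congrFun h₁ ⟨_, hlt⟩
      have h₃ : x.symm (Function.invFun tail (tail x) 0) = 0 :=
        (Function.invFun tail (tail x)).injective (h₂.trans (Equiv.apply_symm_apply x _))
      exact absurd (lt_of_lt_of_eq hlt h₃) (Fin.not_lt_zero _)
    · simp only [show tail x = tail y from funext fun i => hxy i i.2]
  set u : Generator N → Generator N := fun x => x * Equiv.swap m (x.symm (p₀ x)) with hu
  have hum : ∀ x, u x m = p₀ x := fun x => by simp [hu]
  have hui : ∀ x i, x (m + 1) ≠ p₀ x → m < i → u x i = x i := by
    intro x i hx hi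
    have h₁ : x.symm (p₀ x) < m + 1 :=
      lt_of_le_of_ne (hp₀ x) fun e => hx (by rw [← e, Equiv.apply_symm_apply])
    have h₂ : x.symm (p₀ x) ≤ m := by
      rw [Fin.lt_def] at h₁
      rw [Fin.le_def]
      omega
    rw [hu, Equiv.Perm.mul_apply, Equiv.swap_apply_of_ne_of_ne hi.ne' (h₂.trans_lt hi).ne']
  set g : Generator N → ℤˣ := fun x => if x (m + 1) = p₀ x then 1 else ψ (u x) with hg
  have hg₁ : ∀ x, x (m + 1) = p₀ x → g x = 1 := fun x h => if_pos h
  have hg₂ : ∀ x, x (m + 1) ≠ p₀ x → g x = ψ (u x) := fun x h => if_neg h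
  refine ⟨g, fun x a ha => ?_⟩
  rcases ha.lt_or_eq with ha | rfl
  · have h₁ := hsucc a ha
    have hfix : ∀ i, m < i → (x * Equiv.swap a (a + 1)) i = x i := by
      intro i hi
      rw [Fin.lt_def] at ha hi
      rw [Equiv.Perm.mul_apply, Equiv.swap_apply_of_ne_of_ne] <;>
      · rw [Ne, Fin.ext_iff]
        omega
    have hp := hp₀' _ _ fun i hi => hfix i (hmm.trans hi)
    have : g (x * Equiv.swap a (a + 1)) = g x := by
      by_cases hx : x (m + 1) = p₀ x
      · rw [hg₁ _ hx, hg₁ _ (by rw [hfix _ hmm, hx, hp])]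
      · have hx' : (x * Equiv.swap a (a + 1)) (m + 1) ≠ p₀ (x * Equiv.swap a (a + 1)) := by
          rwa [hfix _ hmm, hp]
        rw [hg₂ _ hx, hg₂ _ hx']
        refine hagree fun i hi => ?_
        rcases hi.lt_or_eq with hi | rfl
        · rw [hui _ _ hx hi, hui _ _ hx' hi, hfix i hi]
        · rw [hum, hum, hp]
    rw [this, htriv x a ha, Int.units_mul_self]
  · set y := x * Equiv.swap a (a + 1) with hy
    change ψ x = g x * g y
    have hya : y a = x (a + 1) := by simp [hy]
    have hya1 : y (a + 1) = x a := by simp [hy]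
    have hyi : ∀ i, a + 1 < i → y i = x i := fun i hi => by
      rw [hy, Equiv.Perm.mul_apply, Equiv.swap_apply_of_ne_of_ne (hmm.trans hi).ne' hi.ne']
    have hp : p₀ y = p₀ x := hp₀' _ _ hyi
    have hself : ∀ z : Generator N, z a = p₀ z → g z = ψ z := by
      intro z hz
      have hz' : z (a + 1) ≠ p₀ z := fun e => hmm.ne (z.injective (hz.trans e.symm))
      rw [hg₂ _ hz']
      refine hagree fun i hi => ?_
      rcases hi.lt_or_eq with hi | rfl
      · exact hui _ _ hz' hi
      · rw [hum, hz]
    by_cases h₁ : x (a + 1) = p₀ x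
    · rw [hg₁ x h₁, hself y (by rw [hya, h₁, hp]), one_mul]
      exact (hψs x).symm
    by_cases h₂ : x a = p₀ x
    · rw [hg₁ y (by rw [hya1, h₂, hp]), hself x h₂, mul_one]
    have h₂' : y (a + 1) ≠ p₀ y := by rwa [hya1, hp]
    rw [hg₂ x h₁, hg₂ y h₂']
    -- Now `p₀ x` sits in a row `r` below the row `a`. Move it to the row below `a`, and compare the
    -- values around the hexagon in the three rows up to `a + 1`.
    set r := x.symm (p₀ x) with hr
    have hxr : x r = p₀ x := by rw [hr, Equiv.apply_symm_apply]
    have hra : r < a := by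
      have h₃ := hp₀ x
      have h₄ : r.val ≠ (a + 1).val := fun e => h₁ (by rw [← hxr, Fin.ext e])
      have h₅ : r.val ≠ a.val := fun e => h₂ (by rw [← hxr, Fin.ext e])
      rw [← hr, Fin.le_def] at h₃
      rw [Fin.lt_def]
      omega
    obtain ⟨k, hk⟩ : ∃ k, k + 1 = a := ⟨a - 1, sub_add_cancel a 1⟩
    have hka : k.val + 1 = a.val := by
      rw [Fin.lt_def] at hra
      have := congrArg Fin.val hk
      rw [val_add_one_eq] at this
      split_ifs at this <;> omega
    have hklt : k < a := by rw [Fin.lt_def]; omega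
    set w := x * Equiv.swap k r with hw
    have hwk : w k = p₀ x := by rw [hw, Equiv.Perm.mul_apply, Equiv.swap_apply_left, hxr]
    have hwi : ∀ i, a ≤ i → w i = x i := fun i hi => by
      rw [hw, Equiv.Perm.mul_apply,
        Equiv.swap_apply_of_ne_of_ne (hklt.trans_le hi).ne' (hra.trans_le hi).ne']
    have e := hF.hexagon hinv w hk rfl (hklt.trans hmm).ne'
    have hk1 : ∀ z, F z k a = 1 := fun z => by
      have := htriv z k hklt
      rwa [hk] at this
    rw [hk1, hk1, hk1, one_mul, mul_one, mul_one] at e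
    have e₁ : ψ (w * Equiv.swap k a) = ψ (u x) := by
      refine hagree fun i hi => ?_
      rcases hi.lt_or_eq with hi | rfl
      · rw [hui _ _ h₁ hi, Equiv.Perm.mul_apply,
          Equiv.swap_apply_of_ne_of_ne (hklt.trans hi).ne' hi.ne', hwi i hi.le]
      · rw [hum, Equiv.Perm.mul_apply, Equiv.swap_apply_right, hwk]
    have e₂ : ψ (w * Equiv.swap a (a + 1) * Equiv.swap k a) = ψ (u y) := by
      refine hagree fun i hi => ?_
      rcases hi.lt_or_eq with hi | rfl
      · rw [hui _ _ h₂' hi, Equiv.Perm.mul_apply,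
          Equiv.swap_apply_of_ne_of_ne (hklt.trans hi).ne' hi.ne', Equiv.Perm.mul_apply w,
          hwi _ ?_, hy, Equiv.Perm.mul_apply x]
        rw [Equiv.swap_apply_def]
        split_ifs
        · exact hmm.le
        · exact le_rfl
        · exact hi.le
      · rw [hum, hp, Equiv.Perm.mul_apply, Equiv.swap_apply_right, Equiv.Perm.mul_apply,
          Equiv.swap_apply_of_ne_of_ne hklt.ne (hklt.trans hmm).ne, hwk]
    have e₃ : ψ w = ψ x := hagree hwi
    rw [← e₁, ← e₂, ← e₃]
    have key : ∀ A B C : ℤˣ, A = B * C → B = A * C := by decide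
    exact key _ _ _ e

theorem gauge_invariant (hinv : ∀ x a, F (x * Equiv.swap a (a + 1)) a (a + 1) = F x a (a + 1))
    (g : Generator N → ℤˣ) (x : Generator N) (a : Fin N) :
    g (x * Equiv.swap a (a + 1)) *
          g (x * Equiv.swap a (a + 1) * Equiv.swap a (a + 1)) *
        F (x * Equiv.swap a (a + 1)) a (a + 1) =
      g x * g (x * Equiv.swap a (a + 1)) * F x a (a + 1) := by
  rw [hinv, mul_assoc x, Equiv.swap_mul_self, mul_one, mul_comm (g x)]

theorem IsCocycle.exists_gauge_rows (hF : IsCocycle 1 F)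
    (hinv : ∀ x a, F (x * Equiv.swap a (a + 1)) a (a + 1) = F x a (a + 1)) (m : ℕ) (hm : m < N) :
    ∃ g : Generator N → ℤˣ, ∀ x a, a.val < m →
      F x a (a + 1) = g x * g (x * Equiv.swap a (a + 1)) := by
  induction m with
  | zero => exact ⟨fun _ => 1, fun _ _ h => absurd h (Nat.not_lt_zero _)⟩
  | succ m ih =>
    obtain ⟨g, hg⟩ := ih (by omega)
    obtain ⟨g', hg'⟩ := (hF.gauge g).exists_gauge_row (gauge_invariant hinv g) ⟨m, by omega⟩ hm
      fun x a ha => by rw [hg x a ha, Int.units_mul_self]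
    refine ⟨fun x => g x * g' x, fun x a ha => ?_⟩
    have e := hg' x a (Nat.lt_succ_iff.1 ha)
    have key : ∀ A B C D E : ℤˣ, A * B * E = C * D → E = A * C * (B * D) := by decide
    exact key _ _ _ _ _ e

end Gauge

/-! ### The last row, and injectivity -/

section LastRow

variable {N : ℕ} [N.AtLeastTwo] {F : Generator N → Fin N → Fin N → ℤˣ}

/-- If a flat function is trivial on all rows but the last, then its value on the last row is a
function of the two values of the generator in the last and in the first row. The hexagons and the
thin vertical annuli determine this function. -/
theorem IsCocycle.last_row_eq_one (hF : IsCocycle 1 F)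
    (hinv : ∀ x a, F (x * Equiv.swap a (a + 1)) a (a + 1) = F x a (a + 1))
    (hv : ∀ (x : Generator N) (j : Fin N), j.val + 1 < N →
      F x (x.symm j) (x.symm (j + 1)) * F (x * Equiv.swap (x.symm j) (x.symm (j + 1)))
        (x.symm (j + 1)) (x.symm j) = 1)
    {l : Fin N} (hl : l + 1 = 0) (htriv : ∀ x a, a ≠ l → F x a (a + 1) = 1) (x : Generator N) :
    F x l 0 = 1 := by
  have hl0 : l ≠ 0 := hl ▸ ne_add_one l
  have hinv' : ∀ x, F (x * Equiv.swap l 0) l 0 = F x l 0 := fun x => by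
    have := hinv x l
    rwa [hl] at this
  have hagree : ∀ {x y : Generator N}, x l = y l → x 0 = y 0 → F x l 0 = F y l 0 := by
    intro x y h₁ h₂
    refine eq_of_adjacent_invariant (ψ := fun x => F x l 0) (fun i => i ≠ l ∧ i ≠ 0) 1
      (fun c hc hc1 => ?_) fun i hi => ?_
    · have hcl : c ≠ l := fun e => hc.2 (by rw [e, hl])
      have hc0 : c ≠ 0 := fun e => hc1 (by rw [e, zero_add])
      refine ⟨⟨hcl, hc0⟩, fun u => ?_⟩
      have e := hF.disjoint u hcl hc.1 (by rw [hl]; exact hc0.symm)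
      rwa [htriv _ _ hcl, htriv _ _ hcl, one_mul, one_mul, mul_one, hl] at e
    · by_cases h : i = l
      · rw [h, h₁]
      · rw [not_and_not_right] at hi
        rw [hi h, h₂]
  -- Adjacent columns: the rest of the vertical annulus is a rectangle that avoids the last row.
  have hbase : ∀ y : Generator N, (y l).val + 1 = (y 0).val → F y l 0 = 1 := by
    intro y hy
    have hj : (y l).val + 1 < N := hy ▸ (y 0).isLt
    have hy' : y l + 1 = y 0 := by
      ext
      rw [val_add_one_eq, if_neg hj.ne, hy]
    have e := hv y (y l) hj
    rw [hy', Equiv.symm_apply_apply, Equiv.symm_apply_apply] at e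
    have hs : Spans (y * Equiv.swap l 0) 0 l := by
      refine ⟨hl0.symm, fun i hi => ?_⟩
      have := hi.2
      rw [Equiv.Perm.mul_apply y, Equiv.Perm.mul_apply y, Equiv.swap_apply_left,
        Equiv.swap_apply_right, ← hy'] at this
      exact not_inOpenArc_add_one _ _ this
    rwa [hF.eq_one_of_rows hs, mul_one] at e
    refine fun z c hc => htriv z c ?_
    rintro rfl
    exact lt_irrefl _ hc
  have hstep : ∀ (n : ℕ) (y : Generator N), (y l).val + n + 1 = (y 0).val → F y l 0 = 1 := by
    intro n
    induction n with
    | zero => exact fun y hy => hbase y hy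
    | succ n ih =>
      intro y hy
      have hlt := (y 0).isLt
      -- The row `r` holds a value strictly between those of the last and of the first row.
      set v : Fin N := ⟨(y l).val + n + 1, by omega⟩ with hv'
      have h1l : (0 : Fin N) + 1 ≠ l := by
        intro e
        rw [← e] at hl
        have hN : N = 2 := by
          have := congrArg Fin.val hl
          have h0 : ((0 : Fin N)).val = 0 := rfl
          rw [val_add_one_eq, val_add_one_eq, h0] at this
          have hN : 2 ≤ N := Nat.AtLeastTwo.prop
          split_ifs at this <;> omega
        omega
      have h01 := ne_add_one (0 : Fin N)
      set z := y * Equiv.swap 0 (0 + 1) with hz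
      set r := z.symm v with hr
      have hzr : z r = v := Equiv.apply_symm_apply _ _
      have hzl : z l = y l := by
        rw [hz, Equiv.Perm.mul_apply, Equiv.swap_apply_of_ne_of_ne hl0 h1l.symm]
      have hz1 : z (0 + 1) = y 0 := by
        rw [hz, Equiv.Perm.mul_apply, Equiv.swap_apply_right]
      have hrl : r ≠ l := by
        intro e
        rw [e, hzl, hv', Fin.ext_iff] at hzr
        simp only at hzr
        omega
      have hr1 : r ≠ 0 + 1 := by
        intro e
        rw [e, hz1, hv', Fin.ext_iff] at hzr
        simp only at hzr
        omega
      set w := z * Equiv.swap 0 r with hw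
      have hwl : w l = y l := by
        rw [hw, Equiv.Perm.mul_apply, Equiv.swap_apply_of_ne_of_ne hl0 hrl.symm, hzl]
      have hw1 : w (0 + 1) = y 0 := by
        rw [hw, Equiv.Perm.mul_apply, Equiv.swap_apply_of_ne_of_ne h01.symm hr1.symm, hz1]
      have hw0 : w 0 = v := by rw [hw, Equiv.Perm.mul_apply, Equiv.swap_apply_left, hzr]
      have e := hF.hexagon hinv w hl rfl h1l
      rw [htriv _ 0 hl0.symm, htriv _ 0 hl0.symm, htriv _ 0 hl0.symm, mul_one, one_mul, mul_one,
        ih w (by rw [hwl, hw0]), hbase (w * Equiv.swap l 0 * Equiv.swap 0 (0 + 1)), one_mul] at e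
      · rw [e]
        refine hagree ?_ ?_
        · rw [Equiv.Perm.mul_apply, Equiv.swap_apply_of_ne_of_ne hl0 h1l.symm, hwl]
        · rw [Equiv.Perm.mul_apply, Equiv.swap_apply_left, hw1]
      · have h₁ : (w * Equiv.swap l 0 * Equiv.swap 0 (0 + 1) : Generator N) l = v := by
          rw [Equiv.Perm.mul_apply, Equiv.swap_apply_of_ne_of_ne hl0 h1l.symm,
            Equiv.Perm.mul_apply, Equiv.swap_apply_left, hw0]
        have h₂ : (w * Equiv.swap l 0 * Equiv.swap 0 (0 + 1) : Generator N) 0 = y 0 := by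
          rw [Equiv.Perm.mul_apply, Equiv.swap_apply_left, Equiv.Perm.mul_apply,
            Equiv.swap_apply_of_ne_of_ne h1l h01.symm, hw1]
        rw [h₁, h₂, ← hy, hv']
        simp only
        omega
  have hne : (x l).val ≠ (x 0).val := fun e => hl0 (x.injective (Fin.ext e))
  rcases lt_or_gt_of_ne hne with h | h
  · exact hstep ((x 0).val - (x l).val - 1) x (by omega)
  · rw [← hinv']
    refine hstep ((x l).val - (x 0).val - 1) _ ?_
    rw [Equiv.Perm.mul_apply, Equiv.Perm.mul_apply, Equiv.swap_apply_left, Equiv.swap_apply_right]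
    omega

/-- A flat function whose horizontal values, and all but one of whose vertical values, are trivial
is a coboundary. -/
theorem IsCocycle.exists_gauge (hF : IsCocycle 1 F)
    (hh : ∀ x a, F x a (a + 1) * F (x * Equiv.swap a (a + 1)) a (a + 1) = 1)
    (hv : ∀ (x : Generator N) (j : Fin N), j.val + 1 < N →
      F x (x.symm j) (x.symm (j + 1)) * F (x * Equiv.swap (x.symm j) (x.symm (j + 1)))
        (x.symm (j + 1)) (x.symm j) = 1) :
    ∃ g : Generator N → ℤˣ, ∀ x b t, Spans x b t →
      F x b t = g x * g (x * Equiv.swap b t) := by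
  have hinv : ∀ x a, F (x * Equiv.swap a (a + 1)) a (a + 1) = F x a (a + 1) := fun x a => by
    have key : ∀ A B : ℤˣ, A * B = 1 → B = A := by decide
    exact key _ _ (hh x a)
  have hN : 2 ≤ N := Nat.AtLeastTwo.prop
  obtain ⟨l, hl⟩ : ∃ l : Fin N, l + 1 = 0 := ⟨0 - 1, sub_add_cancel 0 1⟩
  have hlN : l.val + 1 = N := by
    have := congrArg Fin.val hl
    have h0 : ((0 : Fin N)).val = 0 := rfl
    rw [val_add_one_eq, h0] at this
    split_ifs at this with h
    exact h
  obtain ⟨g, hg⟩ := hF.exists_gauge_rows hinv (N - 1) (by omega)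
  have hG := hF.gauge g
  have hGl : ∀ y a, a ≠ l → g y * g (y * Equiv.swap a (a + 1)) * F y a (a + 1) = 1 := by
    intro y a ha
    have ha' : a.val ≠ l.val := fun e => ha (Fin.ext e)
    rw [hg y a (by omega), Int.units_mul_self]
  have hlast := hG.last_row_eq_one (gauge_invariant hinv g) (fun x j hj => by
    rw [Equiv.swap_comm (x.symm (j + 1)), mul_assoc x, Equiv.swap_mul_self, mul_one]
    have key : ∀ A B C D : ℤˣ, C * D = 1 → A * B * C * (B * A * D) = 1 := by decide
    exact key _ _ _ _ (hv x j hj)) hl hGl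
  refine ⟨g, fun x b t hs => ?_⟩
  have e := hG.eq_one_of_rows hs fun y c _ => by
    by_cases hc : c = l
    · rw [hc, hl]
      exact hlast y
    · exact hGl y c hc
  have key : ∀ A B : ℤˣ, A * B = 1 → B = A := by decide
  exact key _ _ e

end LastRow

theorem gaugeEquiv_of_eq {N : ℕ} [N.AtLeastTwo] {s₁ s₂ : SignAssignment N} (x₀ : Generator N)
    (hh : ∀ i, hFun s₁ x₀ i = hFun s₂ x₀ i)
    (hv : ∀ j : Fin N, j.val + 1 < N → vFun s₁ x₀ j = vFun s₂ x₀ j) : GaugeEquiv s₁ s₂ := by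
  have key : ∀ A B C D : ℤˣ, A * B = C * D → A * C * (B * D) = 1 := by decide
  obtain ⟨g, hg⟩ := (s₁.isCocycle.mul s₂.isCocycle).exists_gauge
    (fun x a => by
      have e := hh a
      rw [hFun_independent s₁ x₀ x, hFun_independent s₂ x₀ x, hFun_eq, hFun_eq] at e
      exact key _ _ _ _ e)
    (fun x j hj => by
      have e := hv j hj
      rw [vFun_independent s₁ x₀ x, vFun_independent s₂ x₀ x, vFun_eq, vFun_eq] at e
      exact key _ _ _ _ e)
  refine ⟨g, fun x y R => ?_⟩
  have e := hg x _ _ R.spans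
  rw [onRows_eq (fun _ _ R => s₁.sign R), onRows_eq (fun _ _ R => s₂.sign R), ← R.target] at e
  rw [← e, mul_assoc, Int.units_mul_self, mul_one]

theorem Phi_injective {N : ℕ} [N.AtLeastTwo] (x : Generator N) : Function.Injective (Phi x) := by
  rintro ⟨s₁⟩ ⟨s₂⟩ h
  refine Quotient.sound (gaugeEquiv_of_eq x (fun i => congrFun (congrArg Prod.fst h) i) ?_)
  intro j hj
  exact congrFun (congrArg Prod.snd h) ⟨j.val, by omega⟩

/-! ### The Clifford algebra and the double cover of the symmetric group -/

section Clifford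

variable {N : ℕ}

/-- The algebra of operators on the real functions on `{1, -1}^N`, which contains the Clifford
algebra of `ℝ^N`. -/
abbrev SpinorEnd (N : ℕ) : Type := Module.End ℝ ((Fin N → ℤˣ) → ℝ)

theorem SpinorEnd.mul_neg (g h : SpinorEnd N) : g * -h = -(g * h) := _root_.mul_neg g h

theorem SpinorEnd.neg_mul (g h : SpinorEnd N) : -g * h = -(g * h) := _root_.neg_mul g h

theorem SpinorEnd.units_smul_mul (u : ℤˣ) (g h : SpinorEnd N) : u • g * h = u • (g * h) :=
  smul_mul_assoc u g h

/-- The anticommuting generators `γ_k` of the Clifford algebra, normalized by `γ_k² = 1/2`. In the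
basis of indicator functions, `γ_k` changes the sign of the `k`-th coordinate, with the Jordan–Wigner
sign `∏_{j < k} b j`. -/
noncomputable def gamma (k : Fin N) : SpinorEnd N where
  toFun f b := (√2)⁻¹ * (((∏ j ∈ Finset.Iio k, b j : ℤˣ) : ℤ) : ℝ) * f (b * Pi.mulSingle k (-1))
  map_add' f g := by
    funext b
    simp only [Pi.add_apply]
    ring
  map_smul' c f := by
    funext b
    simp only [Pi.smul_apply, smul_eq_mul, RingHom.id_apply]
    ring

/-- Multiplication by the `k`-th coordinate. -/
noncomputable def zeta (k : Fin N) : SpinorEnd N where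
  toFun f b := ((b k : ℤ) : ℝ) * f b
  map_add' f g := by
    funext b
    simp only [Pi.add_apply]
    ring
  map_smul' c f := by
    funext b
    simp only [Pi.smul_apply, smul_eq_mul, RingHom.id_apply]
    ring

theorem gamma_apply (k : Fin N) (f : (Fin N → ℤˣ) → ℝ) (b : Fin N → ℤˣ) :
    gamma k f b =
      (√2)⁻¹ * (((∏ j ∈ Finset.Iio k, b j : ℤˣ) : ℤ) : ℝ) * f (b * Pi.mulSingle k (-1)) := rfl

theorem zeta_apply (k : Fin N) (f : (Fin N → ℤˣ) → ℝ) (b : Fin N → ℤˣ) :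
    zeta k f b = ((b k : ℤ) : ℝ) * f b := rfl

theorem prod_mul_mulSingle (k i : Fin N) (b : Fin N → ℤˣ) :
    ∏ j ∈ Finset.Iio k, (b * Pi.mulSingle i (-1) : Fin N → ℤˣ) j =
      (∏ j ∈ Finset.Iio k, b j) * if i < k then -1 else 1 := by
  simp only [Pi.mul_apply, Finset.prod_mul_distrib]
  congr 1
  rw [Finset.prod_pi_mulSingle']
  simp

theorem cast_unit_mul_self (u : ℤˣ) : ((u : ℤ) : ℝ) * ((u : ℤ) : ℝ) = 1 := by
  rw [← Int.cast_mul, ← Units.val_mul, Int.units_mul_self, Units.val_one, Int.cast_one]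

theorem inv_sqrt_two_mul_self : (√2)⁻¹ * (√2)⁻¹ = (1 / 2 : ℝ) := by
  rw [← mul_inv, Real.mul_self_sqrt (by norm_num)]
  norm_num

theorem gamma_mul_self (k : Fin N) : gamma k * gamma k = (1 / 2 : ℝ) • (1 : SpinorEnd N) := by
  refine LinearMap.ext fun f => funext fun b => ?_
  rw [Module.End.mul_apply, gamma_apply, gamma_apply, prod_mul_mulSingle, if_neg (lt_irrefl k),
    mul_one, mul_assoc b, ← Pi.mulSingle_mul]
  simp only [mul_neg, mul_one, neg_neg, Pi.mulSingle_one, LinearMap.smul_apply, Module.End.one_apply,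
    Pi.smul_apply, smul_eq_mul]
  rw [← inv_sqrt_two_mul_self]
  linear_combination (√2)⁻¹ * (√2)⁻¹ * f b * cast_unit_mul_self (∏ j ∈ Finset.Iio k, b j)

theorem gamma_anticomm {i k : Fin N} (h : i ≠ k) : gamma i * gamma k = -(gamma k * gamma i) := by
  refine LinearMap.ext fun f => funext fun b => ?_
  rw [LinearMap.neg_apply, Pi.neg_apply, Module.End.mul_apply, Module.End.mul_apply, gamma_apply,
    gamma_apply, gamma_apply, gamma_apply, prod_mul_mulSingle, prod_mul_mulSingle,
    mul_right_comm b]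
  rcases lt_or_gt_of_ne h with h | h
  · rw [if_pos h, if_neg h.not_gt]
    push_cast
    ring
  · rw [if_pos h, if_neg h.not_gt]
    push_cast
    ring

theorem zeta_gamma_self (k : Fin N) : zeta k * gamma k = -(gamma k * zeta k) := by
  refine LinearMap.ext fun f => funext fun b => ?_
  rw [LinearMap.neg_apply, Pi.neg_apply, Module.End.mul_apply, Module.End.mul_apply, gamma_apply,
    zeta_apply, zeta_apply, gamma_apply]
  simp only [Pi.mul_apply, Pi.mulSingle_eq_same]
  push_cast
  ring

theorem zeta_gamma {i k : Fin N} (h : i ≠ k) : zeta k * gamma i = gamma i * zeta k := by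
  refine LinearMap.ext fun f => funext fun b => ?_
  rw [Module.End.mul_apply, Module.End.mul_apply, gamma_apply, zeta_apply, zeta_apply, gamma_apply]
  simp only [Pi.mul_apply, Pi.mulSingle_eq_of_ne h.symm, mul_one]
  ring

/-- The operators `γ_k ζ_k` anticommute with all the generators. -/
theorem gamma_mul_gamma_zeta (i k : Fin N) :
    gamma i * (gamma k * zeta k) = -((gamma k * zeta k) * gamma i) := by
  by_cases h : i = k
  · subst h
    rw [mul_assoc (gamma i), zeta_gamma_self, SpinorEnd.mul_neg, neg_neg]
  · rw [mul_assoc (gamma k), zeta_gamma h, ← mul_assoc, ← mul_assoc, gamma_anticomm h,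
      SpinorEnd.neg_mul]

/-- The generators of the Clifford algebra and the operators `ζ_k` generate the full algebra of
operators, so that only scalars commute with all of them. -/
theorem eq_smul_one_of_commute {g : SpinorEnd N} (hγ : ∀ k, g * gamma k = gamma k * g)
    (hζ : ∀ k, g * zeta k = zeta k * g) : ∃ a : ℝ, g = a • 1 := by
  set e : (Fin N → ℤˣ) → (Fin N → ℤˣ) → ℝ := fun b => Pi.single b 1 with he
  have hζe : ∀ k, zeta k (e 1) = e 1 := by
    intro k
    funext b
    rw [zeta_apply]
    by_cases hb : b = 1
    · simp [hb]
    · simp [he, hb]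
  have hγe : ∀ k b, gamma k (e b) =
      ((√2)⁻¹ * (((∏ j ∈ Finset.Iio k, b j : ℤˣ) : ℤ) : ℝ)) • e (b * Pi.mulSingle k (-1)) := by
    intro k b
    have hm : (Pi.mulSingle k (-1) : Fin N → ℤˣ) * Pi.mulSingle k (-1) = 1 := by
      rw [← Pi.mulSingle_mul]
      simp
    funext c
    rw [gamma_apply, Pi.smul_apply, smul_eq_mul]
    by_cases hc : c = b * Pi.mulSingle k (-1)
    · rw [hc, prod_mul_mulSingle, if_neg (lt_irrefl k), mul_one, mul_assoc b, hm, mul_one]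
      simp [he]
    · have hc' : c * Pi.mulSingle k (-1) ≠ b := by
        rintro rfl
        rw [mul_assoc, hm, mul_one] at hc
        exact hc rfl
      simp [he, hc, hc']
  have hvac : g (e 1) = (g (e 1) 1) • e 1 := by
    funext b
    by_cases hb : b = 1
    · simp [hb, he]
    obtain ⟨k, hk⟩ : ∃ k, b k ≠ 1 := by
      by_contra! h
      exact hb (funext h)
    have h₁ : g (e 1) = zeta k (g (e 1)) := by
      rw [← Module.End.mul_apply, ← hζ, Module.End.mul_apply, hζe]
    have h₂ := congrFun h₁ b
    rw [zeta_apply, (Int.units_eq_one_or (b k)).resolve_left hk] at h₂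
    push_cast at h₂
    have h₃ : g (e 1) b = 0 := by linarith
    rw [h₃]
    simp [he, hb]
  have hstep : ∀ k b, g (e b) = (g (e 1) 1) • e b →
      g (e (b * Pi.mulSingle k (-1))) = (g (e 1) 1) • e (b * Pi.mulSingle k (-1)) := by
    intro k b hb
    have hne : (√2)⁻¹ * (((∏ j ∈ Finset.Iio k, b j : ℤˣ) : ℤ) : ℝ) ≠ 0 := by
      refine mul_ne_zero (by positivity) ?_
      exact_mod_cast Units.ne_zero _
    have h₁ : g (gamma k (e b)) = gamma k (g (e b)) := by
      rw [← Module.End.mul_apply, hγ, Module.End.mul_apply]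
    rw [hb, map_smul, hγe, map_smul, smul_comm] at h₁
    exact smul_right_injective _ hne h₁
  have hall : ∀ (b : Fin N → ℤˣ) (s : Finset (Fin N)),
      g (e (∏ k ∈ s, Pi.mulSingle k (b k))) = (g (e 1) 1) • e (∏ k ∈ s, Pi.mulSingle k (b k)) := by
    intro b s
    induction s using Finset.induction_on with
    | empty => simpa using hvac
    | insert k s hk ih =>
      rw [Finset.prod_insert hk, mul_comm]
      rcases Int.units_eq_one_or (b k) with h | h
      · rwa [h, Pi.mulSingle_one, mul_one]
      · rw [h]
        exact hstep k _ ih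
  refine ⟨g (e 1) 1, ?_⟩
  refine (Pi.basisFun ℝ (Fin N → ℤˣ)).ext fun b => ?_
  have := hall b Finset.univ
  rw [Finset.univ_prod_mulSingle] at this
  simpa [he] using this

/-- The lift `γ_i - γ_j` of the transposition of `i` and `j`. -/
noncomputable def root (i j : Fin N) : SpinorEnd N := gamma i - gamma j

theorem root_swap (i j : Fin N) : root j i = -root i j := by
  rw [root, root, neg_sub]

theorem root_mul_self {i j : Fin N} (h : i ≠ j) : root i j * root i j = 1 := by
  rw [root, mul_sub, sub_mul, sub_mul, gamma_mul_self, gamma_mul_self, gamma_anticomm h]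
  simp only [sub_neg_eq_add, neg_sub_left]
  module

theorem root_mul_root_disjoint {i j k l : Fin N} (hik : i ≠ k) (hil : i ≠ l) (hjk : j ≠ k)
    (hjl : j ≠ l) : root i j * root k l = -(root k l * root i j) := by
  rw [root, root, mul_sub, sub_mul, sub_mul, mul_sub, sub_mul, sub_mul, gamma_anticomm hik,
    gamma_anticomm hil, gamma_anticomm hjk, gamma_anticomm hjl]
  abel

theorem root_mul_root_cycle {i j k : Fin N} (hij : i ≠ j) (hik : i ≠ k) (hjk : j ≠ k) :
    root i j * root j k = root j k * root k i := by
  simp only [root, mul_sub, sub_mul]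
  rw [gamma_mul_self, gamma_mul_self, gamma_anticomm hij, gamma_anticomm hik, gamma_anticomm hjk]
  abel

theorem root_mul_gamma (i j k : Fin N) :
    root i j * gamma k = -(gamma (Equiv.swap i j k) * root i j) := by
  rw [root, sub_mul, mul_sub]
  by_cases hi : k = i
  · rw [hi, Equiv.swap_apply_left, gamma_mul_self, gamma_mul_self]
    abel
  by_cases hj : k = j
  · rw [hj, Equiv.swap_apply_right, gamma_mul_self, gamma_mul_self]
    abel
  rw [Equiv.swap_apply_of_ne_of_ne hi hj, gamma_anticomm (Ne.symm hi), gamma_anticomm (Ne.symm hj)]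
  abel

theorem root_mul_gamma_zeta (i j k : Fin N) :
    root i j * (gamma k * zeta k) = -((gamma k * zeta k) * root i j) := by
  rw [root, sub_mul, mul_sub, gamma_mul_gamma_zeta, gamma_mul_gamma_zeta]
  abel

/-- `g` is a lift of the permutation `σ` to the double cover of the symmetric group that is
generated by the lifts `γ_i - γ_j` of the transpositions. -/
inductive IsLift : SpinorEnd N → Equiv.Perm (Fin N) → Prop
  | one : IsLift 1 1
  | mul_root {g : SpinorEnd N} {σ : Equiv.Perm (Fin N)} {i j : Fin N} :
      IsLift g σ → i ≠ j → IsLift (g * root i j) (σ * Equiv.swap i j)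

theorem exists_isLift (σ : Equiv.Perm (Fin N)) : ∃ g, IsLift g σ := by
  induction σ using Equiv.Perm.swap_induction_on' with
  | one => exact ⟨1, .one⟩
  | mul_swap σ i j h ih =>
    obtain ⟨g, hg⟩ := ih
    exact ⟨_, hg.mul_root h⟩

theorem IsLift.mul {g h : SpinorEnd N} {σ τ : Equiv.Perm (Fin N)} (hg : IsLift g σ)
    (hh : IsLift h τ) : IsLift (g * h) (σ * τ) := by
  induction hh with
  | one => simpa using hg
  | mul_root _ hij ih =>
    rw [← mul_assoc, ← mul_assoc]
    exact ih.mul_root hij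

theorem IsLift.exists_inv {g : SpinorEnd N} {σ : Equiv.Perm (Fin N)} (hg : IsLift g σ) :
    ∃ g', IsLift g' σ⁻¹ ∧ g * g' = 1 := by
  induction hg with
  | one => exact ⟨1, by simpa using IsLift.one, one_mul 1⟩
  | @mul_root g σ i j hg hij ih =>
    obtain ⟨g', hg', h⟩ := ih
    refine ⟨root i j * g', ?_, ?_⟩
    · have := (IsLift.one.mul_root hij).mul hg'
      rw [one_mul, one_mul] at this
      rwa [mul_inv_rev, Equiv.swap_inv]
    · rw [mul_assoc, ← mul_assoc (root i j), root_mul_self hij, one_mul, h]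

theorem IsLift.mul_gamma {g : SpinorEnd N} {σ : Equiv.Perm (Fin N)} (hg : IsLift g σ)
    (k : Fin N) : g * gamma k = Equiv.Perm.sign σ • (gamma (σ k) * g) := by
  induction hg generalizing k with
  | one => simp
  | mul_root _ hij ih =>
    rw [mul_assoc, root_mul_gamma, SpinorEnd.mul_neg, ← mul_assoc, ih, Equiv.Perm.sign_mul,
      Equiv.Perm.sign_swap hij, mul_neg_one, Units.neg_smul, SpinorEnd.units_smul_mul, mul_assoc]
    rfl

theorem IsLift.mul_gamma_zeta {g : SpinorEnd N} {σ : Equiv.Perm (Fin N)} (hg : IsLift g σ)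
    (k : Fin N) :
    g * (gamma k * zeta k) = Equiv.Perm.sign σ • ((gamma k * zeta k) * g) := by
  induction hg with
  | one => simp
  | mul_root _ hij ih =>
    rw [mul_assoc, root_mul_gamma_zeta, SpinorEnd.mul_neg, ← mul_assoc, ih, Equiv.Perm.sign_mul,
      Equiv.Perm.sign_swap hij, mul_neg_one, Units.neg_smul, SpinorEnd.units_smul_mul,
      mul_assoc (gamma k * _)]

theorem IsLift.det_sq {g : SpinorEnd N} {σ : Equiv.Perm (Fin N)} (hg : IsLift g σ) :
    LinearMap.det g * LinearMap.det g = 1 := by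
  induction hg with
  | one => simp
  | mul_root _ hij ih =>
    rw [map_mul, mul_mul_mul_comm, ih, ← map_mul, root_mul_self hij, map_one, one_mul]

/-- The kernel of the double cover is `{1, -1}`. -/
theorem IsLift.eq_one_or_neg_one {g : SpinorEnd N} (hg : IsLift g 1) : g = 1 ∨ g = -1 := by
  have hγ : ∀ k, g * gamma k = gamma k * g := fun k => by simpa using hg.mul_gamma k
  have hζ : ∀ k, g * zeta k = zeta k * g := by
    intro k
    have h₁ : g * (gamma k * zeta k) = gamma k * zeta k * g := by simpa using hg.mul_gamma_zeta k
    have h₂ : gamma k * (g * zeta k) = gamma k * (zeta k * g) := by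
      rw [← mul_assoc, ← hγ, mul_assoc, h₁, mul_assoc]
    have h₃ := congrArg (fun h => gamma k * h) h₂
    simp only [← mul_assoc, gamma_mul_self, smul_mul_assoc, one_mul] at h₃
    exact smul_right_injective _ (by norm_num) h₃
  obtain ⟨a, rfl⟩ := eq_smul_one_of_commute hγ hζ
  have hd := hg.det_sq
  rw [LinearMap.det_smul, map_one, mul_one, ← mul_pow] at hd
  have ha : a * a = 1 := by
    refine (pow_eq_one_iff_of_nonneg (mul_self_nonneg a) ?_).1 hd
    rw [Module.finrank_fintype_fun_eq_card]
    exact Fintype.card_ne_zero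
  rcases mul_self_eq_one_iff.1 ha with rfl | rfl
  · left; exact one_smul ℝ (1 : SpinorEnd N)
  · right; exact neg_one_smul ℝ (1 : SpinorEnd N)

theorem IsLift.eq_or_neg {g h : SpinorEnd N} {σ : Equiv.Perm (Fin N)} (hg : IsLift g σ)
    (hh : IsLift h σ) : ∃ u : ℤˣ, g = u • h := by
  obtain ⟨h', hh', e⟩ := hh.exists_inv
  have e' : h' * h = 1 := mul_eq_one_comm.1 e
  have := hg.mul hh'
  rw [mul_inv_cancel] at this
  have hgh : g = g * h' * h := by rw [mul_assoc, e', mul_one]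
  rcases this.eq_one_or_neg_one with h₁ | h₁
  · exact ⟨1, by rw [hgh, h₁]; simp⟩
  · exact ⟨-1, by rw [hgh, h₁, SpinorEnd.neg_mul, one_mul, Units.neg_smul, one_smul]⟩

theorem IsLift.smul_injective {g : SpinorEnd N} {σ : Equiv.Perm (Fin N)} (hg : IsLift g σ)
    {u v : ℤˣ} (h : u • g = v • g) : u = v := by
  obtain ⟨g', -, e⟩ := hg.exists_inv
  have h₁ := congrArg (fun f => f * g') h
  simp only [SpinorEnd.units_smul_mul, e] at h₁
  have h₂ := congrFun (LinearMap.congr_fun h₁ fun _ => 1) 1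
  rcases Int.units_eq_one_or u with rfl | rfl <;> rcases Int.units_eq_one_or v with rfl | rfl <;>
    first | rfl | (exfalso; simp [Units.smul_def] at h₂; linarith)

end Clifford

/-! ### Orientations of the rectangles in two factorizations -/

section Orientation

variable {N : ℕ}

theorem eq_or_eq_of_swap_eq_swap {a b c d : Fin N} (hab : a ≠ b)
    (h : Equiv.swap a b = Equiv.swap c d) : c = a ∧ d = b ∨ c = b ∧ d = a := by
  have e := Equiv.congr_fun h a
  rw [Equiv.swap_apply_left, Equiv.swap_apply_def] at e
  split_ifs at e with h₁ h₂
  · exact .inl ⟨h₁.symm, e.symm⟩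
  · exact .inr ⟨e.symm, h₂.symm⟩
  · exact absurd e.symm hab

theorem swap_mul_swap_apply_ne {a b c d : Fin N} (hcd : c ≠ d)
    (h : Equiv.swap a b * Equiv.swap c d ≠ 1) : (Equiv.swap a b * Equiv.swap c d) c ≠ c := by
  intro e
  rw [Equiv.Perm.mul_apply, Equiv.swap_apply_left, Equiv.swap_apply_def] at e
  split_ifs at e with h₁ h₂
  · rw [e, ← h₁, Equiv.swap_comm, Equiv.swap_mul_self] at h
    exact h rfl
  · rw [e, ← h₂, Equiv.swap_mul_self] at h
    exact h rfl
  · exact hcd e.symm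

/-- The two factorizations of a product of two commuting transpositions. -/
theorem swap_mul_swap_disjoint {a b c d a' b' c' d' : Fin N} (hab : a ≠ b) (hcd : c ≠ d)
    (hac : a ≠ c) (had : a ≠ d) (hbc : b ≠ c) (hbd : b ≠ d) (hc'd' : c' ≠ d')
    (h : Equiv.swap a b * Equiv.swap c d = Equiv.swap a' b' * Equiv.swap c' d')
    (hne : Equiv.swap a b ≠ Equiv.swap a' b') :
    (a' = c ∧ b' = d ∨ a' = d ∧ b' = c) ∧ (c' = a ∧ d' = b ∨ c' = b ∧ d' = a) := by
  have hcomm : Equiv.swap a b * Equiv.swap c d = Equiv.swap c d * Equiv.swap a b := by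
    rw [Equiv.mul_swap_eq_swap_mul, Equiv.swap_apply_of_ne_of_ne hac.symm hbc.symm,
      Equiv.swap_apply_of_ne_of_ne had.symm hbd.symm]
  have ha : (Equiv.swap a b * Equiv.swap c d) a = b := by
    rw [Equiv.Perm.mul_apply, Equiv.swap_apply_of_ne_of_ne hac had, Equiv.swap_apply_left]
  have hb : (Equiv.swap a b * Equiv.swap c d) b = a := by
    rw [Equiv.Perm.mul_apply, Equiv.swap_apply_of_ne_of_ne hbc hbd, Equiv.swap_apply_right]
  have hc : (Equiv.swap a b * Equiv.swap c d) c = d := by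
    rw [hcomm, Equiv.Perm.mul_apply, Equiv.swap_apply_of_ne_of_ne hac.symm hbc.symm,
      Equiv.swap_apply_left]
  have hd : (Equiv.swap a b * Equiv.swap c d) d = c := by
    rw [hcomm, Equiv.Perm.mul_apply, Equiv.swap_apply_of_ne_of_ne had.symm hbd.symm,
      Equiv.swap_apply_right]
  have h1 : Equiv.swap a b * Equiv.swap c d ≠ 1 := fun e => hab (by
    have := Equiv.congr_fun e a
    rw [ha] at this
    exact this.symm)
  set π := Equiv.swap a b * Equiv.swap c d with hπ
  have hππ : ∀ i, π (π i) = i := by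
    intro i
    rw [← Equiv.Perm.mul_apply]
    nth_rewrite 2 [hcomm]
    rw [hπ, mul_assoc, ← mul_assoc (Equiv.swap c d), Equiv.swap_mul_self, one_mul,
      Equiv.swap_mul_self, Equiv.Perm.one_apply]
  have hfix : π c' ≠ c' := by
    rw [h] at h1 ⊢
    exact swap_mul_swap_apply_ne hc'd' h1
  have hτ : Equiv.swap a' b' = π * Equiv.swap c' d' := by
    rw [h, mul_assoc, Equiv.swap_mul_self, mul_one]
  -- The first factor on the right is an involution, and so `π` exchanges `c'` and `d'`.
  have hd' : π c' = d' := by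
    by_contra hcon
    have e₁ : Equiv.swap a' b' d' = π c' := by
      rw [hτ, Equiv.Perm.mul_apply, Equiv.swap_apply_right]
    have e₂ : Equiv.swap a' b' (π c') = c' := by
      rw [hτ, Equiv.Perm.mul_apply, Equiv.swap_apply_of_ne_of_ne hfix hcon, hππ]
    rw [← e₁, Equiv.swap_apply_self] at e₂
    exact hc'd' e₂.symm
  have hmem : c' = a ∨ c' = b ∨ c' = c ∨ c' = d := by
    by_contra! hcon
    refine hfix ?_
    rw [hπ, Equiv.Perm.mul_apply, Equiv.swap_apply_of_ne_of_ne hcon.2.2.1 hcon.2.2.2,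
      Equiv.swap_apply_of_ne_of_ne hcon.1 hcon.2.1]
  have hτ₁ : Equiv.swap c' d' = Equiv.swap a b → Equiv.swap c d = Equiv.swap a' b' := fun e => by
    rw [hτ, e, hcomm, mul_assoc, Equiv.swap_mul_self, mul_one]
  have hτ₂ : Equiv.swap c' d' = Equiv.swap c d → False := fun e => hne (by
    rw [hτ, e, hπ, mul_assoc, Equiv.swap_mul_self, mul_one])
  rcases hmem with rfl | rfl | rfl | rfl
  · rw [ha] at hd'
    exact ⟨eq_or_eq_of_swap_eq_swap hcd (hτ₁ (by rw [hd'])), .inl ⟨rfl, hd'.symm⟩⟩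
  · rw [hb] at hd'
    exact ⟨eq_or_eq_of_swap_eq_swap hcd (hτ₁ (by rw [hd', Equiv.swap_comm])), .inr ⟨rfl, hd'.symm⟩⟩
  · rw [hc] at hd'
    exact (hτ₂ (by rw [hd'])).elim
  · rw [hd] at hd'
    exact (hτ₂ (by rw [hd', Equiv.swap_comm])).elim

/-- The other two factorizations of a `3`-cycle as a product of two transpositions. -/
theorem swap_mul_swap_cycle {i j k a' b' c' d' : Fin N} (hij : i ≠ j) (hik : i ≠ k) (hjk : j ≠ k)
    (hc'd' : c' ≠ d')
    (h : Equiv.swap i j * Equiv.swap j k = Equiv.swap a' b' * Equiv.swap c' d')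
    (hne : Equiv.swap i j ≠ Equiv.swap a' b') :
    ((a' = j ∧ b' = k ∨ a' = k ∧ b' = j) ∧ (c' = k ∧ d' = i ∨ c' = i ∧ d' = k)) ∨
    ((a' = k ∧ b' = i ∨ a' = i ∧ b' = k) ∧ (c' = i ∧ d' = j ∨ c' = j ∧ d' = i)) := by
  have h1 : Equiv.swap i j * Equiv.swap j k ≠ 1 := fun e => hij (by
    have := Equiv.congr_fun e k
    rw [Equiv.Perm.mul_apply, Equiv.swap_apply_right, Equiv.swap_apply_right] at this
    exact absurd this hik)
  set π := Equiv.swap i j * Equiv.swap j k with hπ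
  have hmem : ∀ l, π l ≠ l → l = i ∨ l = j ∨ l = k := by
    intro l hl
    by_contra! hcon
    refine hl ?_
    rw [hπ, Equiv.Perm.mul_apply, Equiv.swap_apply_of_ne_of_ne hcon.2.1 hcon.2.2,
      Equiv.swap_apply_of_ne_of_ne hcon.1 hcon.2.1]
  have hc' : π c' ≠ c' := by
    rw [h] at h1 ⊢
    exact swap_mul_swap_apply_ne hc'd' h1
  have hd' : π d' ≠ d' := by
    rw [h, Equiv.swap_comm c' d'] at h1 ⊢
    exact swap_mul_swap_apply_ne hc'd'.symm h1
  have hτ : Equiv.swap a' b' = π * Equiv.swap c' d' := by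
    rw [h, mul_assoc, Equiv.swap_mul_self, mul_one]
  have h₁ : Equiv.swap c' d' = Equiv.swap i j → Equiv.swap k i = Equiv.swap a' b' := fun e => by
    rw [hτ, e, hπ, Equiv.swap_comm i j, Equiv.swap_comm j k,
      Equiv.swap_mul_swap_mul_swap hjk.symm hik.symm, Equiv.swap_comm]
  have h₂ : Equiv.swap c' d' = Equiv.swap j k → False := fun e => hne (by
    rw [hτ, e, hπ, mul_assoc, Equiv.swap_mul_self, mul_one])
  have h₃ : Equiv.swap c' d' = Equiv.swap k i → Equiv.swap j k = Equiv.swap a' b' := fun e => by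
    rw [hτ, e, hπ, swap_mul_swap_middle hik hjk, Equiv.mul_swap_eq_swap_mul (Equiv.swap i k) i j,
      Equiv.swap_apply_left, Equiv.swap_apply_of_ne_of_ne hij.symm hjk, mul_assoc,
      Equiv.swap_comm k i, Equiv.swap_mul_self, mul_one, Equiv.swap_comm]
  rcases hmem c' hc' with rfl | rfl | rfl <;> rcases hmem d' hd' with rfl | rfl | rfl
  · exact absurd rfl hc'd'
  · exact .inr ⟨eq_or_eq_of_swap_eq_swap hik.symm (h₁ rfl), .inl ⟨rfl, rfl⟩⟩
  · exact .inl ⟨eq_or_eq_of_swap_eq_swap hjk (h₃ (Equiv.swap_comm _ _)), .inr ⟨rfl, rfl⟩⟩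
  · exact .inr ⟨eq_or_eq_of_swap_eq_swap hik.symm (h₁ (Equiv.swap_comm _ _)), .inr ⟨rfl, rfl⟩⟩
  · exact absurd rfl hc'd'
  · exact (h₂ rfl).elim
  · exact .inl ⟨eq_or_eq_of_swap_eq_swap hjk (h₃ rfl), .inl ⟨rfl, rfl⟩⟩
  · exact (h₂ (Equiv.swap_comm _ _)).elim
  · exact absurd rfl hc'd'

/-- The indicator function of the arc from `a` to `b` jumps up at `a` and down at `b`. -/
theorem arcIndicator_jump [N.AtLeastTwo] {a b : Fin N} (h : a ≠ b) (c : Fin N) :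
    arcIndicator a b (c + 1) - arcIndicator a b c =
      (if c + 1 = a then 1 else 0) - if c + 1 = b then 1 else 0 := by
  have h' : a.val ≠ b.val := fun e => h (Fin.ext e)
  have ha := a.isLt
  have hb := b.isLt
  have hc := c.isLt
  unfold arcIndicator InArc
  simp only [val_sub_eq, Fin.ext_iff, val_add_one_eq]
  split_ifs <;> omega

/-- In an `L`-shape with rows `i`, `j`, `k`, the lifts of the four transpositions anticommute in the
appropriate sense. Comparing the horizontal edges of the two factorizations at the circles `α_i` and
`α_k` fixes how the rectangles are oriented relative to each other, up to configurations in which one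
of the rectangles is not empty. -/
theorem root_mul_root_of_overlap [N.AtLeastTwo] {x : Generator N}
    {i j k b₁ t₁ b₂ t₂ b₁' t₁' b₂' t₂' : Fin N} (hij : i ≠ j) (hik : i ≠ k) (hjk : j ≠ k)
    (h₁ : i = b₁ ∧ j = t₁ ∨ j = b₁ ∧ i = t₁) (h₂ : j = b₂ ∧ k = t₂ ∨ k = b₂ ∧ j = t₂)
    (h₁' : j = b₁' ∧ k = t₁' ∨ k = b₁' ∧ j = t₁') (h₂' : k = b₂' ∧ i = t₂' ∨ i = b₂' ∧ k = t₂')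
    (hs : Spans x b₁ t₁) (hs' : Spans (x * Equiv.swap b₁' t₁') b₂' t₂')
    (hc : ∀ col row,
      arcIndicator (x b₁) (x t₁) col * arcIndicator b₁ t₁ row +
        arcIndicator ((x * Equiv.swap b₁ t₁) b₂) ((x * Equiv.swap b₁ t₁) t₂) col *
          arcIndicator b₂ t₂ row =
      arcIndicator (x b₁') (x t₁') col * arcIndicator b₁' t₁' row +
        arcIndicator ((x * Equiv.swap b₁' t₁') b₂') ((x * Equiv.swap b₁' t₁') t₂') col *
          arcIndicator b₂' t₂' row) :
    root b₁ t₁ * root b₂ t₂ = -(root b₁' t₁' * root b₂' t₂') := by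
  have hzj : (x * Equiv.swap b₁ t₁) j = x i := by
    rcases h₁ with ⟨rfl, rfl⟩ | ⟨rfl, rfl⟩ <;> simp
  have hzk : (x * Equiv.swap b₁ t₁) k = x k := by
    rcases h₁ with ⟨rfl, rfl⟩ | ⟨rfl, rfl⟩ <;>
      simp [Equiv.swap_apply_of_ne_of_ne, hik.symm, hjk.symm]
  have hzi' : (x * Equiv.swap b₁' t₁') i = x i := by
    rcases h₁' with ⟨rfl, rfl⟩ | ⟨rfl, rfl⟩ <;>
      simp [Equiv.swap_apply_of_ne_of_ne, hij, hik]
  have hzj' : (x * Equiv.swap b₁' t₁') j = x k := by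
    rcases h₁' with ⟨rfl, rfl⟩ | ⟨rfl, rfl⟩ <;> simp
  have hzk' : (x * Equiv.swap b₁' t₁') k = x j := by
    rcases h₁' with ⟨rfl, rfl⟩ | ⟨rfl, rfl⟩ <;> simp
  generalize x * Equiv.swap b₁ t₁ = z at hzj hzk hc
  generalize x * Equiv.swap b₁' t₁' = z' at hzi' hzj' hzk' hc hs'
  have hn₁ : b₁ ≠ t₁ := hs.1
  have hn₂ : b₂ ≠ t₂ := by rcases h₂ with ⟨rfl, rfl⟩ | ⟨rfl, rfl⟩; exacts [hjk, hjk.symm]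
  have hn₁' : b₁' ≠ t₁' := by rcases h₁' with ⟨rfl, rfl⟩ | ⟨rfl, rfl⟩; exacts [hjk, hjk.symm]
  have hn₂' : b₂' ≠ t₂' := hs'.1
  have hJ : ∀ col p,
      arcIndicator (x b₁) (x t₁) col * ((if p = b₁ then 1 else 0) - if p = t₁ then 1 else 0) +
        arcIndicator (z b₂) (z t₂) col * ((if p = b₂ then 1 else 0) - if p = t₂ then 1 else 0) =
      arcIndicator (x b₁') (x t₁') col *
          ((if p = b₁' then 1 else 0) - if p = t₁' then 1 else 0) +
        arcIndicator (z' b₂') (z' t₂') col *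
          ((if p = b₂' then 1 else 0) - if p = t₂' then 1 else 0) := by
    intro col p
    obtain ⟨q, rfl⟩ : ∃ q, q + 1 = p := ⟨p - 1, sub_add_cancel p 1⟩
    rw [← arcIndicator_jump hn₁, ← arcIndicator_jump hn₂, ← arcIndicator_jump hn₁',
      ← arcIndicator_jump hn₂']
    linear_combination hc col (q + 1) - hc col q
  clear hc
  have hXY := x.injective.ne hij
  have hXZ := x.injective.ne hik
  have hYZ := x.injective.ne hjk
  have aXY := arcIndicator_left hXY
  have aYX := arcIndicator_left hXY.symm
  have aXZ := arcIndicator_left hXZ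
  have aZX := arcIndicator_left hXZ.symm
  have aYZ := arcIndicator_left hYZ
  have aZY := arcIndicator_left hYZ.symm
  have sXY := arcIndicator_swap hXY
  have sXZ := arcIndicator_swap hXZ
  have sYZ := arcIndicator_swap hYZ
  have n := @arcIndicator_nonneg N
  have ei := hJ (x i) i
  have ekx := hJ (x i) k
  have ekz := hJ (x k) k
  have sXZ' := sXZ (x i)
  have sXZ'' := sXZ (x k)
  have sXY' := sXY (x i)
  have sYZ' := sYZ (x k)
  have n₁ := n (x j) (x i) (x k)
  have n₂ := n (x i) (x j) (x k)
  have n₃ := n (x k) (x j) (x i)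
  clear hJ sXY sXZ sYZ n
  have cyc := root_mul_root_cycle hij hik hjk
  rcases h₁ with ⟨rfl, rfl⟩ | ⟨rfl, rfl⟩ <;> rcases h₂ with ⟨rfl, rfl⟩ | ⟨rfl, rfl⟩ <;>
    rcases h₁' with ⟨rfl, rfl⟩ | ⟨rfl, rfl⟩ <;> rcases h₂' with ⟨rfl, rfl⟩ | ⟨rfl, rfl⟩ <;>
    simp only [hzj, hzk, hzi', hzk', if_true, if_false, hij, hik, hik.symm, hjk.symm]
      at ei ekx ekz <;>
    try (exfalso; omega)
  · simp only [root_swap k i, SpinorEnd.mul_neg, neg_neg, cyc]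
  · have hX : InOpenArc (x i) (x j) (x k) := inOpenArc_of_arcIndicator (by omega) hXZ.symm
    rcases inOpenArc_total hij hik hjk with h | h
    · exact absurd ⟨h, hX⟩ (hs.2 k)
    · exact absurd ⟨h.rotate.rotate, by rwa [hzi', hzk', hzj']⟩ (hs'.2 j)
  · simp only [root_swap k i, root_swap j k, SpinorEnd.mul_neg, SpinorEnd.neg_mul, neg_neg, cyc]
  · simp only [root_swap i j, SpinorEnd.neg_mul, cyc]
  · have hX : InOpenArc (x j) (x i) (x k) := inOpenArc_of_arcIndicator (by omega) hYZ.symm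
    rcases inOpenArc_total hij hik hjk with h | h
    · exact absurd ⟨h.rotate, by rwa [hzi', hzk', hzj']⟩ (hs'.2 j)
    · exact absurd ⟨h, hX⟩ (hs.2 k)
  · simp only [root_swap i j, root_swap j k, SpinorEnd.mul_neg, SpinorEnd.neg_mul, neg_neg, cyc]

/-- Over any domain with two factorizations into rectangles, the lifts of the transpositions
anticommute. -/
theorem root_mul_root_of_chain [N.AtLeastTwo] {x : Generator N}
    {b₁ t₁ b₂ t₂ b₁' t₁' b₂' t₂' : Fin N} (hs₁ : Spans x b₁ t₁)
    (hs₂ : Spans (x * Equiv.swap b₁ t₁) b₂ t₂) (hs₁' : Spans x b₁' t₁')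
    (hs₂' : Spans (x * Equiv.swap b₁' t₁') b₂' t₂')
    (hy : Equiv.swap b₁ t₁ * Equiv.swap b₂ t₂ = Equiv.swap b₁' t₁' * Equiv.swap b₂' t₂')
    (hy1 : Equiv.swap b₁ t₁ * Equiv.swap b₂ t₂ ≠ 1) (hz : Equiv.swap b₁ t₁ ≠ Equiv.swap b₁' t₁')
    (hc : ∀ col row,
      arcIndicator (x b₁) (x t₁) col * arcIndicator b₁ t₁ row +
        arcIndicator ((x * Equiv.swap b₁ t₁) b₂) ((x * Equiv.swap b₁ t₁) t₂) col *
          arcIndicator b₂ t₂ row =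
      arcIndicator (x b₁') (x t₁') col * arcIndicator b₁' t₁' row +
        arcIndicator ((x * Equiv.swap b₁' t₁') b₂') ((x * Equiv.swap b₁' t₁') t₂') col *
          arcIndicator b₂' t₂' row) :
    root b₁ t₁ * root b₂ t₂ = -(root b₁' t₁' * root b₂' t₂') := by
  by_cases hd : (b₁ ≠ b₂ ∧ b₁ ≠ t₂) ∧ t₁ ≠ b₂ ∧ t₁ ≠ t₂
  · obtain ⟨⟨d₁, d₂⟩, d₃, d₄⟩ := hd
    have key := root_mul_root_disjoint d₁ d₂ d₃ d₄
    have a₁ := arcIndicator_left (x.injective.ne hs₁.1)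
    have a₂ := arcIndicator_left hs₁.1
    have a₃ := arcIndicator_left (x.injective.ne hs₂.1)
    have a₄ := arcIndicator_left hs₂.1
    have a₅ := arcIndicator_swap hs₁.1 b₁
    have a₆ := arcIndicator_swap hs₂.1 b₂
    rcases swap_mul_swap_disjoint hs₁.1 hs₂.1 d₁ d₂ d₃ d₄ hs₂'.1 hy hz with
      ⟨⟨rfl, rfl⟩ | ⟨rfl, rfl⟩, ⟨rfl, rfl⟩ | ⟨rfl, rfl⟩⟩
    · exact key
    -- If just one of the two rectangles is turned around, then the chains differ.
    · have := hc (x t₂') t₂'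
      simp only [Equiv.Perm.mul_apply, Equiv.swap_apply_of_ne_of_ne d₁ d₂,
        Equiv.swap_apply_of_ne_of_ne d₃ d₄, Equiv.swap_apply_of_ne_of_ne d₁.symm d₃.symm,
        Equiv.swap_apply_of_ne_of_ne d₂.symm d₄.symm, a₁, a₂] at this
      rw [show arcIndicator b₂' t₂' t₂' = 0 by omega] at this
      omega
    · have := hc (x t₁') t₁'
      simp only [Equiv.Perm.mul_apply, Equiv.swap_apply_of_ne_of_ne d₂ d₁,
        Equiv.swap_apply_of_ne_of_ne d₄ d₃, Equiv.swap_apply_of_ne_of_ne d₁.symm d₃.symm,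
        Equiv.swap_apply_of_ne_of_ne d₂.symm d₄.symm, a₃, a₄] at this
      rw [show arcIndicator b₁' t₁' t₁' = 0 by omega] at this
      omega
    · rw [key, root_swap b₂' t₂', root_swap b₁' t₁']
      simp only [SpinorEnd.mul_neg, SpinorEnd.neg_mul, neg_neg]
  · obtain ⟨i, j, k, hij, hik, hjk, h₁, h₂⟩ : ∃ i j k : Fin N, i ≠ j ∧ i ≠ k ∧ j ≠ k ∧
        (i = b₁ ∧ j = t₁ ∨ j = b₁ ∧ i = t₁) ∧ (j = b₂ ∧ k = t₂ ∨ k = b₂ ∧ j = t₂) := by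
      have hn₁ := hs₁.1
      have hn₂ := hs₂.1
      by_cases e₁ : b₁ = b₂
      · subst e₁
        refine ⟨t₁, b₁, t₂, hn₁.symm, ?_, hn₂, .inr ⟨rfl, rfl⟩, .inl ⟨rfl, rfl⟩⟩
        rintro rfl
        exact hy1 (Equiv.swap_mul_self _ _)
      by_cases e₂ : b₁ = t₂
      · subst e₂
        refine ⟨t₁, b₁, b₂, hn₁.symm, ?_, hn₂.symm, .inr ⟨rfl, rfl⟩, .inr ⟨rfl, rfl⟩⟩
        rintro rfl
        rw [Equiv.swap_comm, Equiv.swap_mul_self] at hy1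
        exact hy1 rfl
      by_cases e₃ : t₁ = b₂
      · subst e₃
        exact ⟨b₁, t₁, t₂, hn₁, e₂, hn₂, .inl ⟨rfl, rfl⟩, .inl ⟨rfl, rfl⟩⟩
      by_cases e₄ : t₁ = t₂
      · subst e₄
        exact ⟨b₁, t₁, b₂, hn₁, e₁, hn₂.symm, .inl ⟨rfl, rfl⟩, .inr ⟨rfl, rfl⟩⟩
      exact absurd ⟨⟨e₁, e₂⟩, e₃, e₄⟩ hd
    have e₁ : Equiv.swap b₁ t₁ = Equiv.swap i j := by
      rcases h₁ with ⟨rfl, rfl⟩ | ⟨rfl, rfl⟩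
      exacts [rfl, Equiv.swap_comm _ _]
    have e₂ : Equiv.swap b₂ t₂ = Equiv.swap j k := by
      rcases h₂ with ⟨rfl, rfl⟩ | ⟨rfl, rfl⟩
      exacts [rfl, Equiv.swap_comm _ _]
    have hcomm : ∀ a b c d : Fin N, a = c ∧ b = d ∨ a = d ∧ b = c →
        c = a ∧ d = b ∨ d = a ∧ c = b := by
      rintro a b c d (⟨rfl, rfl⟩ | ⟨rfl, rfl⟩)
      exacts [.inl ⟨rfl, rfl⟩, .inr ⟨rfl, rfl⟩]
    rcases swap_mul_swap_cycle hij hik hjk hs₂'.1 (by rw [← e₁, ← e₂, hy]) (e₁ ▸ hz) with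
      ⟨h₁', h₂'⟩ | ⟨h₁', h₂'⟩
    · exact root_mul_root_of_overlap hij hik hjk h₁ h₂ (hcomm _ _ _ _ h₁') (hcomm _ _ _ _ h₂') hs₁
        hs₂' hc
    -- Here the two factorizations exchange their roles.
    · rw [root_mul_root_of_overlap hik.symm hjk.symm hij (hcomm _ _ _ _ h₁') (hcomm _ _ _ _ h₂')
        h₁ h₂ hs₁' hs₂ (fun col row => (hc col row).symm), neg_neg]

end Orientation

/-! ### Existence of a sign assignment -/

section Existence

variable {N : ℕ}

/-- A lift of each permutation to the double cover. -/
noncomputable def spinLift (σ : Equiv.Perm (Fin N)) : SpinorEnd N := (exists_isLift σ).choose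

theorem isLift_spinLift (σ : Equiv.Perm (Fin N)) : IsLift (spinLift σ) σ :=
  (exists_isLift σ).choose_spec

theorem exists_spinSign (x : Generator N) (b t : Fin N) :
    ∃ u : ℤˣ, b ≠ t → spinLift x * root b t = u • spinLift (x * Equiv.swap b t) := by
  by_cases h : b = t
  · exact ⟨1, fun h' => absurd h h'⟩
  · obtain ⟨u, hu⟩ := ((isLift_spinLift x).mul_root h).eq_or_neg (isLift_spinLift _)
    exact ⟨u, fun _ => hu⟩

/-- The sign that compares the chosen lift of the target of a rectangle to the lift that the
rectangle induces from the chosen lift of its source. -/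
noncomputable def spinSign (x : Generator N) (b t : Fin N) : ℤˣ := (exists_spinSign x b t).choose

theorem spinLift_mul_root (x : Generator N) {b t : Fin N} (h : b ≠ t) :
    spinLift x * root b t = spinSign x b t • spinLift (x * Equiv.swap b t) :=
  (exists_spinSign x b t).choose_spec h

theorem spinLift_mul_root_mul_root (x : Generator N) {b₁ t₁ b₂ t₂ : Fin N} (h₁ : b₁ ≠ t₁)
    (h₂ : b₂ ≠ t₂) :
    spinLift x * (root b₁ t₁ * root b₂ t₂) =
      (spinSign x b₁ t₁ * spinSign (x * Equiv.swap b₁ t₁) b₂ t₂) •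
        spinLift (x * Equiv.swap b₁ t₁ * Equiv.swap b₂ t₂) := by
  rw [← mul_assoc, spinLift_mul_root x h₁, SpinorEnd.units_smul_mul, spinLift_mul_root _ h₂,
    smul_smul]

theorem spinSign_isCocycle [N.AtLeastTwo] : IsCocycle (-1) (spinSign (N := N)) := by
  intro x b₁ t₁ b₂ t₂ b₁' t₁' b₂' t₂' h₁ h₂ h₁' h₂' hy hyx hz hc
  have hy' : Equiv.swap b₁ t₁ * Equiv.swap b₂ t₂ = Equiv.swap b₁' t₁' * Equiv.swap b₂' t₂' := by
    rwa [mul_assoc, mul_assoc, mul_right_inj] at hy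
  have hy1 : Equiv.swap b₁ t₁ * Equiv.swap b₂ t₂ ≠ 1 := by
    rwa [mul_assoc, Ne, mul_eq_left] at hyx
  have hz' : Equiv.swap b₁ t₁ ≠ Equiv.swap b₁' t₁' := fun e => hz (by rw [e])
  have e₁ := spinLift_mul_root_mul_root x h₁.1 h₂.1
  have e₂ := spinLift_mul_root_mul_root x h₁'.1 h₂'.1
  rw [root_mul_root_of_chain h₁ h₂ h₁' h₂' hy' hy1 hz' hc, SpinorEnd.mul_neg, e₂, ← hy,
    ← Units.neg_smul] at e₁
  rw [neg_one_mul]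
  exact ((isLift_spinLift _).smul_injective e₁).symm

/-- A cocycle with `ε = -1`, as a sign assignment. -/
def IsCocycle.signAssignment {F : Generator N → Fin N → Fin N → ℤˣ} (hF : IsCocycle (-1) F) :
    SignAssignment N where
  sign {x _} R := F x R.bottom R.top
  anticomm := by
    intro x y z z' hxy _ _ _ _ hzz R₁ R₂ R₁' R₂' h
    have hz := R₁.target
    have hz' := R₁'.target
    have hy := R₂.target
    have hy' := R₂'.target
    have e := hF x R₁.bottom R₁.top R₂.bottom R₂.top R₁'.bottom R₁'.top R₂'.bottom R₂'.top R₁.spans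
    rw [← hz, ← hz', ← hy, ← hy', R₁.bottomLeft, R₁.topRight, R₂.bottomLeft, R₂.topRight,
      R₁'.bottomLeft, R₁'.topRight, R₂'.bottomLeft, R₂'.topRight, neg_one_mul] at e
    refine e R₂.spans R₁'.spans R₂'.spans rfl hxy.symm hzz fun col row => ?_
    have := congrFun (congrFun h col) row
    simpa only [Pi.add_apply, Rectangle.chain_apply] using this

end Existence

/-! ### The number of gauge equivalence classes -/

section Count

variable {N : ℕ}

/-- The homomorphism from chains to signs with the values `l` on the elementary domains. -/
def chainSign (l : Fin N → Fin N → ℤˣ) (D : Chain N) : ℤˣ := ∏ col, ∏ row, l col row ^ D col row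

theorem chainSign_add (l : Fin N → Fin N → ℤˣ) (D E : Chain N) :
    chainSign l (D + E) = chainSign l D * chainSign l E := by
  simp only [chainSign, Pi.add_apply, zpow_add, Finset.prod_mul_distrib]

theorem chainSign_horizontalAnnulus (l : Fin N → Fin N → ℤˣ) (i : Fin N) :
    chainSign l (horizontalAnnulus i) = ∏ col, l col i := by
  refine Finset.prod_congr rfl fun col _ => ?_
  rw [Finset.prod_eq_single i]
  · simp [horizontalAnnulus]
  · intro row _ h
    simp [horizontalAnnulus, h]
  · exact fun h => absurd (Finset.mem_univ _) h

theorem chainSign_verticalAnnulus (l : Fin N → Fin N → ℤˣ) (j : Fin N) :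
    chainSign l (verticalAnnulus j) = ∏ row, l j row := by
  rw [chainSign, Finset.prod_eq_single j]
  · simp [verticalAnnulus]
  · intro col _ h
    simp [verticalAnnulus, h]
  · exact fun h => absurd (Finset.mem_univ _) h

/-- The product of a sign assignment and of the signs of the chains of the rectangles. -/
noncomputable def SignAssignment.twist (s : SignAssignment N) (l : Fin N → Fin N → ℤˣ) :
    SignAssignment N where
  sign R := s.sign R * chainSign l R.chain
  anticomm h₁ h₂ h₃ h₄ h₅ h₆ R₁ R₂ R₁' R₂' h := by
    rw [mul_mul_mul_comm, ← chainSign_add, h, chainSign_add,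
      s.anticomm h₁ h₂ h₃ h₄ h₅ h₆ R₁ R₂ R₁' R₂' h, neg_mul, mul_mul_mul_comm]

theorem Decomposition.signProd_twist {x : Generator N} {D : Chain N} (d : Decomposition x D)
    (s : SignAssignment N) (l : Fin N → Fin N → ℤˣ) :
    d.signProd (s.twist l) = d.signProd s * chainSign l D := by
  have : chainSign l D = chainSign l d.fst.chain * chainSign l d.snd.chain := by
    rw [← chainSign_add, d.sum_eq]
  rw [this]
  exact mul_mul_mul_comm _ _ _ _

/-- There are chain signs with prescribed values on the horizontal annuli and on all but one of the
vertical annuli. -/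
theorem exists_chainSign [N.AtLeastTwo] (a b : Fin N → ℤˣ) : ∃ l : Fin N → Fin N → ℤˣ,
    (∀ i, chainSign l (horizontalAnnulus i) = a i) ∧
      ∀ j : Fin N, j.val < N - 1 → chainSign l (verticalAnnulus j) = b j := by
  have hN : 2 ≤ N := Nat.AtLeastTwo.prop
  let m : Fin N := ⟨N - 1, by omega⟩
  -- The values in the last column give the rows their products. The values in the first row give
  -- the other columns theirs, and have the product `1`.
  let c : Fin N → ℤˣ := Function.update b m (∏ j ∈ Finset.univ \ {m}, b j)
  have hc : ∏ j, c j = 1 := by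
    rw [Finset.prod_update_of_mem (Finset.mem_univ m), Int.units_mul_self]
  refine ⟨fun col row => (if col = m then a row else 1) * if row = 0 then c col else 1,
    fun i => ?_, fun j hj => ?_⟩
  · rw [chainSign_horizontalAnnulus, Finset.prod_mul_distrib, Finset.prod_ite_eq',
      if_pos (Finset.mem_univ m)]
    split_ifs
    · rw [hc, mul_one]
    · rw [Finset.prod_const_one, mul_one]
  · have hjm : j ≠ m := fun e => hj.ne (congrArg Fin.val e)
    rw [chainSign_verticalAnnulus, Finset.prod_mul_distrib, Finset.prod_ite_eq',
      if_pos (Finset.mem_univ _)]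
    simp [hjm, c]

theorem Phi_surjective [N.AtLeastTwo] (x : Generator N) : Function.Surjective (Phi x) := by
  rintro ⟨h, v⟩
  set s₀ : SignAssignment N := (spinSign_isCocycle (N := N)).signAssignment
  obtain ⟨l, hl₁, hl₂⟩ := exists_chainSign (fun i => hFun s₀ x i * h i)
    fun j => vFun s₀ x j * if hj : j.val < N - 1 then v ⟨j.val, hj⟩ else 1
  refine ⟨Quotient.mk _ (s₀.twist l), Prod.ext (funext fun i => ?_) (funext fun j => ?_)⟩
  · change (horizontalDecomposition x i).signProd (s₀.twist l) = h i
    rw [Decomposition.signProd_twist, hl₁, ← mul_assoc]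
    exact (congrArg (· * h i) (Int.units_mul_self _)).trans (one_mul _)
  · change (verticalDecomposition x (j.castLE (Nat.sub_le N 1))).signProd (s₀.twist l) = v j
    rw [Decomposition.signProd_twist, hl₂ _ j.isLt, ← mul_assoc, 
      dif_pos (show (j.castLE (Nat.sub_le N 1)).val < N - 1 from j.isLt)]
    exact (congrArg (· * v j) (Int.units_mul_self _)).trans (one_mul _)

theorem card_gaugeClass [N.AtLeastTwo] : Nat.card (GaugeClass N) = 2 ^ (2 * N - 1) := by
  have hN : 2 ≤ N := Nat.AtLeastTwo.prop
  rw [Nat.card_congr (Equiv.ofBijective (Phi (1 : Generator N))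
    ⟨Phi_injective 1, Phi_surjective 1⟩), Nat.card_eq_fintype_card]
  simp only [Fintype.card_prod, Fintype.card_pi, Fintype.card_units_int, Finset.prod_const,
    Finset.card_univ, Fintype.card_fin]
  rw [← pow_add]
  congr 1
  omega

end Count

end Grid

/-- For a toroidal grid diagram of index `N ≥ 2`: the horizontal and vertical functions do not depend
on the generator at which they are computed, the map `Φ` on gauge equivalence classes of sign
assignments is injective, and there are exactly `2 ^ (2 * N - 1)` such classes. -/
theorem mainTheorem7 (N : ℕ) [N.AtLeastTwo] :
    (∀ (s : Grid.SignAssignment N) (x y : Grid.Generator N) (i : Fin N),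
      Grid.hFun s x i = Grid.hFun s y i ∧ Grid.vFun s x i = Grid.vFun s y i) ∧
    (∀ x : Grid.Generator N, Function.Injective (Grid.Phi x)) ∧
    Nat.card (Grid.GaugeClass N) = 2 ^ (2 * N - 1) := by
  exact ⟨fun s x y i => ⟨Grid.hFun_independent s x y i, Grid.vFun_independent s x y i⟩,
    Grid.Phi_injective, Grid.card_gaugeClass⟩
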